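/- **Setting.** Let $F:\mathbb R^d\to\mathbb R^d$ be monotone, $L_1$-Lipschitz ($L_1>0$) and differentiable, with Jacobian $\nabla F$ that is $L_2$-Lipschitz in operator norm ($L_2\ge 0$). Let $\mathcal L$ be a linear subspace of $\mathbb R^{d\times d}$ with $I\in\mathcal L$ and $\nabla F(z)\in\mathcal L$ for all $z$, and let $P_{\mathcal L}$ be the Frobenius-orthogonal projection onto $\mathcal L$. Put $$\mathcal Z=\{B\in\mathcal L: 0\preceq\tfrac12(B+B^\top)\preceq L_1I,\ \|B\|_{op}\le L_1\},\qquad \mathcal C=\{B\in\mathcal L: -I\preceq\tfrac12(B+B^\top)\preceq I,\ \|B\|_{op}\le 3\}.$$ The inputs of the method are $z_0\in\mathbb R^d$, $B_0\in\mathcal Z$, $\alpha_1,\alpha_2\in(0,\frac12)$, $\beta\in(0,1)$, $\sigma_0\ge\frac{\alpha_2\beta}{5L_1}$, $p\in(0,1)$, $\rho=\frac1{121}$, $\delta_t=\frac1{2(t+1)^{1/4}}$, $q_t=\frac{p}{2.5\,(t+1)\log^2(t+1)}$ for $t\ge1$, and a radius $R$ with $\|A\|_F\le R$ for all $A\in\mathcal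 C$ and $R\le 3\sqrt d$ (such as $R=3\sqrt d$, or $R=\sqrt d$ if all matrices in $\mathcal L$ are symmetric). **Oracles.** Call $(\gamma,S)$ with $\gamma>0$ and $S$ symmetric a *successful* output of $\mathsf{ExtEvec}(W;\delta)$ if either $\gamma\le1$ and $-(1+\delta)I\preceq\frac12(W+W^\top)\preceq(1+\delta)I$; or $\gamma>1$, $-(1+\delta)I\preceq\frac1{2\gamma}(W+W^\top)\preceq(1+\delta)I$, $\|S\|_F\le1$, and $\langle S,W-B\rangle\ge\gamma-1$ for every $B$ with $-I\preceq\frac12(B+B^\top)\preceq I$. Call $(\gamma,S)$ with $\gamma>0$ a *successful* output of $\mathsf{MaxSvec}(W;\delta)$ if either $\gamma\le1$ and $\|W\|_{op}\le3(1+\delta)$; or $\gamma>1$, $\|W/\gamma\|_{op}\le3(1+\delta)$, $\|S\|_F\le1$, and $\langle S,W-B\rangle\ge\gamma-1$ for every $B$ with $\|B\|_{op}\le3$. **Method (QNPE with Option II).** The learner's round counter starts at $t=0$, with matrix $B_0$ and $W_0=(B_0-L_1I)/L_1$. In iteration $k=0,1,2,\dots$, with current learner matrix $B_t$: 1. *Line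 search.* For $\eta=\sigma_k,\sigma_k\beta,\sigma_k\beta^2,\dots$ compute a point $\hat z=z_k+s$ with $\|(I+\eta B_t)s+\eta F(z_k)\|\le\alpha_1\|s\|$, until $\|\hat z-z_k+\eta F(\hat z)\|\le(\alpha_1+\alpha_2)\|\hat z-z_k\|$ (if equality holds with $\hat z\ne z_k$, the point may be accepted or rejected). Let $\eta_k,\hat z_k$ be the accepted pair. 2. *Step.* $z_{k+1}=z_k-\eta_kF(\hat z_k)$ and $\sigma_{k+1}=\eta_k/\beta$. 3. *Learner.* If $\eta_k=\sigma_k$, keep $B_t,W_t$ and $t$. Otherwise let $\tilde z_k$ be the last rejected point, $s=\tilde z_k-z_k$, $u=F(\tilde z_k)-F(z_k)$, $\ell_t(B)=\|u-Bs\|^2/\|s\|^2$ and $G_t=P_{\mathcal L}\nabla\ell_t(B_t)/L_1$. Let $\tilde G_t=G_t$ if $t=0$ or $\gamma_t\le1$, and $\tilde G_t=G_t+\max\{0,-\langle G_t,W_t\rangle/\gamma_t\}S_t$ otherwise. Let $W_{t+1}$ be the projection of $W_t-\rho\tilde G_t$ onto $\{\|W\|_F\le R\}$. Increase $t$ by one.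 For this new $t$, call $\mathsf{ExtEvec}(W_t;\delta_t)$ and $\mathsf{MaxSvec}(W_t;\delta_t)$, let $\gamma_t$ be the larger of the two returned numbers and $S_t$ the projection $P_{\mathcal L}$ of the matrix returned with it, and set $B_t=L_1I+\dfrac{L_1W_t}{(1+\delta_t)\max\{1,\gamma_t\}}$. Assume that, for each $t\ge 1$, each of the two oracle calls of round $t$ is unsuccessful with probability at most $q_t/2$. **Gap.** Let $\bar z_k=\sum_{i<k}\eta_i\hat z_i/\sum_{i<k}\eta_i$. For a nonempty compact set $\mathcal D$, $\mathrm{Gap}(z;\mathcal D)$ denotes $\max_{z'\in\mathcal D}\langle F(z'),z-z'\rangle$ for the equation $F(z)=0$; $\max_{z'\in\mathcal D}(f(z)-f(z'))$ if $F=\nabla f$ comes from minimizing $f$; and $\max_{(x',y')\in\mathcal D}(f(x,y')-f(x',y))$, with $z=(x,y)$, if $F=(\nabla_xf,-\nabla_yf)$ comes from $\min_x\max_yf(x,y)$. **Theorem.** With probability at least $1-p$ the following holds, for every such problem, every nonempty compact $\mathcal D\subset\mathbb R^d$, every $z^*$ with $F(z^*)=0$ and every $k\ge1$, with $M=\max_{z\in\mathcal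 D}\|z_0-z\|^2$. (a) $\|z_{j+1}-z^*\|\le\|z_j-z^*\|$ for all $j\ge 0$, and $$\mathrm{Gap}(\bar z_k;\mathcal D)\le\frac{5L_1M}{2\alpha_2\beta k}$$ (this gap bound also holds when $F$ has no zero). (b) With $$C=\frac{(1+\alpha_1)^2}{2(1-\alpha_1)^2\beta^2(1-\alpha_1-\alpha_2)},\qquad Q_1=\frac{9\sqrt2\,\|B_0-\nabla F(z_0)\|_F}{L_1}+\frac{\sqrt{2C}\,L_2\|z_0-z^*\|}{L_1},$$ $$Q_2=\sqrt{\frac{648\sqrt2\,d\,L_2\|z_0-z^*\|}{\sqrt{1-\alpha_1-\alpha_2}\,L_1}}+6\sqrt2,$$ one has $$\mathrm{Gap}(\bar z_k;\mathcal D)\le\frac{L_1M}{2(1-\beta)\alpha_2\beta}\Big(\frac5{k^2}+\frac{Q_1}{k^{1.5}}+\frac{Q_2}{k^{1.25}}\Big).$$ (c) There is a constant $c>0$ depending only on $\alpha_1,\alpha_2,\beta$ such that, with $\lambda=L_2\|z_0-z^*\|/L_1$, $$Q_1\le c(\sqrt d+\lambda),\qquad Q_2\le c(\sqrt{d\lambda}+1),\qquad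 \mathrm{Gap}(\bar z_k;\mathcal D)\le c(1+\lambda)\,L_1M\,\min\Big\{\frac1k,\frac{\sqrt d}{k^{1.25}}\Big\}.$$ -/

import Mathlib

open scoped RealInnerProductSpace

noncomputable section

namespace QNPE

/-- Vectors of `ℝ^d` with the Euclidean norm. -/
abbrev Vec (d : ℕ) := EuclideanSpace ℝ (Fin d)

/-- Real `d × d` matrices. -/
abbrev Mat (d : ℕ) := Matrix (Fin d) (Fin d) ℝ

variable {d : ℕ}

/-! ### Matrices -/

/-- Matrix-vector product `A v`. -/
def mv (A : Mat d) (v : Vec d) : Vec d := Matrix.toEuclideanCLM (𝕜 := ℝ) A v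

/-- Operator norm with respect to the Euclidean norm. -/
def opNorm (A : Mat d) : ℝ := ‖Matrix.toEuclideanCLM (𝕜 := ℝ) A‖

/-- Frobenius inner product. -/
def frobInner (A B : Mat d) : ℝ := ∑ i, ∑ j, A i j * B i j

/-- Frobenius norm. -/
def frobNorm (A : Mat d) : ℝ := Real.sqrt (frobInner A A)

/-- Symmetric part `(A + Aᵀ) / 2`. -/
def symPart (A : Mat d) : Mat d := (1 / 2 : ℝ) • (A + A.transpose)

/-- Loewner order: `A ≼ B` iff `B - A` is positive semidefinite. -/
def LoewnerLE (A B : Mat d) : Prop := (B - A).PosSemidef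

/-- `PA` is the orthogonal projection of `A` onto the subspace `𝓛` (Frobenius inner product). -/
def IsFrobProj (𝓛 : Submodule ℝ (Mat d)) (A PA : Mat d) : Prop :=
  PA ∈ 𝓛 ∧ ∀ B ∈ 𝓛, frobInner (A - PA) B = 0

/-- Euclidean projection onto the Frobenius ball of radius `R` around `0`:
`R • A / max {R, ‖A‖_F}`. -/
def ballProj (R : ℝ) (A : Mat d) : Mat d := (R / max R (frobNorm A)) • A

/-- The Jacobian matrix of `F` at `z`. -/
def jac (F : Vec d → Vec d) (z : Vec d) : Mat d :=
  (Matrix.toEuclideanCLM (𝕜 := ℝ) (n := Fin d)).symm (fderiv ℝ F z)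

/-! ### Feasible sets of Jacobian approximations (strong monotonicity parameter `μ = 0`) -/

/-- `𝒵 = {B : 0 ≼ (B + Bᵀ)/2 ≼ L₁ I, ‖B‖_op ≤ L₁, B ∈ 𝓛}`. -/
def setZ (L₁ : ℝ) (𝓛 : Submodule ℝ (Mat d)) : Set (Mat d) :=
  {B | LoewnerLE 0 (symPart B) ∧ LoewnerLE (symPart B) (L₁ • (1 : Mat d)) ∧ opNorm B ≤ L₁ ∧ B ∈ 𝓛}

/-- `𝒞 = {B : -I ≼ (B + Bᵀ)/2 ≼ I, ‖B‖_op ≤ 3, B ∈ 𝓛}`, the feasible set after the change of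
variables `B ↦ (B - L₁ I) / L₁`. -/
def setC (𝓛 : Submodule ℝ (Mat d)) : Set (Mat d) :=
  {B | LoewnerLE (-1) (symPart B) ∧ LoewnerLE (symPart B) 1 ∧ opNorm B ≤ 3 ∧ B ∈ 𝓛}

/-! ### Oracles: what their outputs have to satisfy -/

/-- `s` is an admissible output of `LinearSolver (A, b; ρ)`. -/
def LinearSolverOutput (A : Mat d) (b : Vec d) (ρ : ℝ) (s : Vec d) : Prop :=
  ‖mv A s - b‖ ≤ ρ * ‖s‖

/-- The output `out = (γ, S)` of a call `ExtEvec (W; δ, q)` is successful. -/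
def ExtEvecSuccess (W : Mat d) (δ : ℝ) (out : ℝ × Mat d) : Prop :=
  0 < out.1 ∧ out.2.IsSymm ∧
  (out.1 ≤ 1 →
    LoewnerLE (-((1 + δ) • (1 : Mat d))) (symPart W) ∧
    LoewnerLE (symPart W) ((1 + δ) • (1 : Mat d))) ∧
  (1 < out.1 →
    LoewnerLE (-((1 + δ) • (1 : Mat d))) (out.1⁻¹ • symPart W) ∧
    LoewnerLE (out.1⁻¹ • symPart W) ((1 + δ) • (1 : Mat d)) ∧
    frobNorm out.2 ≤ 1 ∧
    ∀ B : Mat d, LoewnerLE (-1) (symPart B) → LoewnerLE (symPart B) 1 →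
      out.1 - 1 ≤ frobInner out.2 (W - B))

/-- The output `out = (γ, S)` of a call `MaxSvec (W; δ, q)` is successful. -/
def MaxSvecSuccess (W : Mat d) (δ : ℝ) (out : ℝ × Mat d) : Prop :=
  0 < out.1 ∧
  (out.1 ≤ 1 → opNorm W ≤ 3 * (1 + δ)) ∧
  (1 < out.1 →
    opNorm (out.1⁻¹ • W) ≤ 3 * (1 + δ) ∧
    frobNorm out.2 ≤ 1 ∧
    ∀ B : Mat d, opNorm B ≤ 3 → out.1 - 1 ≤ frobInner out.2 (W - B))

/-! ### The loss functions of the online learning problem -/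

/-- `ℓ(B) = ‖u - B s‖² / ‖s‖²`. -/
def loss (u s : Vec d) (B : Mat d) : ℝ := ‖u - mv B s‖ ^ 2 / ‖s‖ ^ 2

/-- `∇ℓ(B) = -2 (u - B s) sᵀ / ‖s‖²`. -/
def lossGrad (u s : Vec d) (B : Mat d) : Mat d :=
  Matrix.of fun i j => -2 * (u - mv B s) i * s j / ‖s‖ ^ 2

/-- `lossGrad` is the gradient of `loss` for the Frobenius inner product. -/
theorem hasDerivAt_loss (u s : Vec d) (B H : Mat d) :
    HasDerivAt (fun τ : ℝ => loss u s (B + τ • H)) (frobInner (lossGrad u s B) H) 0 := by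
  have h1 : HasDerivAt (fun τ : ℝ => u - mv (B + τ • H) s) (-(mv H s)) 0 := by
    have h : (fun τ : ℝ => u - mv (B + τ • H) s) = fun τ : ℝ => (u - mv B s) - τ • mv H s := by
      funext τ
      simp [mv, map_add, map_smul, sub_sub]
    rw [h]
    simpa using ((hasDerivAt_id (0 : ℝ)).smul_const (mv H s)).const_sub (u - mv B s)
  have h2 := (h1.norm_sq).div_const (‖s‖ ^ 2)
  have h3 : frobInner (lossGrad u s B) H =
      2 * ⟪u - mv (B + (0 : ℝ) • H) s, -(mv H s)⟫ / ‖s‖ ^ 2 := by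
    have e : ∀ i, mv H s i = ∑ j, H i j * s j := fun i => rfl
    simp only [zero_smul, add_zero, inner_neg_right]
    rw [PiLp.inner_apply]
    simp only [frobInner, lossGrad, Matrix.of_apply, e, RCLike.inner_apply, conj_trivial,
      Finset.sum_mul, mul_neg, Finset.mul_sum, ← Finset.sum_neg_distrib, Finset.sum_div]
    exact Finset.sum_congr rfl fun i _ => Finset.sum_congr rfl fun j _ => by ring
  rw [h3]
  exact h2

/-! ### The algorithm -/

/-- The input of the QNPE method in the monotone setting (`μ = 0`). -/
structure Input (d : ℕ) where
  /-- the operator -/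
  F : Vec d → Vec d
  /-- initial point -/
  z₀ : Vec d
  /-- initial Jacobian approximation -/
  B₀ : Mat d
  /-- subspace encoding the structure of the Jacobian -/
  𝓛 : Submodule ℝ (Mat d)
  /-- Lipschitz constant of `F` -/
  L₁ : ℝ
  /-- accuracy of the linear solver -/
  α₁ : ℝ
  /-- line search parameter -/
  α₂ : ℝ
  /-- backtracking factor -/
  β : ℝ
  /-- initial trial step size -/
  σ₀ : ℝ
  /-- step size of the online learner -/
  ρ : ℝ
  /-- radius of the ball onto which the online learner projects -/
  R : ℝ
  /-- oracle accuracies -/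
  δ : ℕ → ℝ

/-- The sequences generated by one execution of QNPE with backtracking line search and the
Option II Jacobian update. Iterations are indexed by `k`. The online learner is called only at the
iterations where the line search backtracks, and its rounds are indexed by `t`; `round k` is the
round in progress at iteration `k`, i.e. the number of earlier backtracking iterations.
If an execution has only finitely many rounds, the entries of later rounds are dummies. -/
structure Run (I : Input d) where
  /-- iterates `z_k` -/
  z : ℕ → Vec d
  /-- initial trial step size `σ_k` of iteration `k` -/
  σ : ℕ → ℝ
  /-- number of step sizes rejected by the line search at iteration `k` -/
  rej : ℕ → ℕ
  /-- `trial k i` is the point computed in iteration `k` with the step size `σ_k β^i` -/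
  trial : ℕ → ℕ → Vec d
  /-- round of the online learner in progress at iteration `k` -/
  round : ℕ → ℕ
  /-- Jacobian approximation played in round `t` -/
  B : ℕ → Mat d
  /-- auxiliary iterate of the online learner in round `t` -/
  W : ℕ → Mat d
  /-- output of `ExtEvec (W_t; δ_t, q_t / 2)` -/
  ext : ℕ → ℝ × Mat d
  /-- output of `MaxSvec (W_t; δ_t, q_t / 2)` -/
  svd : ℕ → ℝ × Mat d
  /-- the number `γ_t` -/
  γ : ℕ → ℝ
  /-- the matrix `S_t` -/
  S : ℕ → Mat d
  /-- scaled and projected loss gradient `G_t` -/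
  G : ℕ → Mat d
  z_zero : z 0 = I.z₀
  σ_zero : σ 0 = I.σ₀
  round_zero : round 0 = 0
  B_zero : B 0 = I.B₀
  W_zero : W 0 = I.L₁⁻¹ • (I.B₀ - I.L₁ • (1 : Mat d))
  /-- every trial point comes from the linear solver -/
  solver : ∀ k i, i ≤ rej k →
    LinearSolverOutput (1 + (σ k * I.β ^ i) • B (round k)) (-((σ k * I.β ^ i) • I.F (z k)))
      I.α₁ (trial k i - z k)
  /-- the first `rej k` trial points violate the line search condition (in a tie, a trial point
  different from `z_k` may be rejected or accepted) -/
  rejected : ∀ k i, i < rej k → trial k i ≠ z k ∧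
    (I.α₁ + I.α₂) * ‖trial k i - z k‖ ≤
      ‖trial k i - z k + (σ k * I.β ^ i) • I.F (trial k i)‖
  /-- the next trial point satisfies it -/
  accepted : ∀ k,
    ‖trial k (rej k) - z k + (σ k * I.β ^ rej k) • I.F (trial k (rej k))‖ ≤
      (I.α₁ + I.α₂) * ‖trial k (rej k) - z k‖
  /-- extragradient step -/
  z_succ : ∀ k, z (k + 1) = z k - (σ k * I.β ^ rej k) • I.F (trial k (rej k))
  /-- warm start `σ_{k+1} = η_k / β` -/
  σ_succ : ∀ k, σ (k + 1) = σ k * I.β ^ rej k / I.β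
  /-- the learner moves on exactly when the line search has backtracked -/
  round_succ : ∀ k, round (k + 1) = if rej k = 0 then round k else round k + 1
  /-- `G_t = P ∇ℓ_t(B_t) / L₁`, where `ℓ_t` is built from the last rejected trial point -/
  grad : ∀ k, rej k ≠ 0 →
    IsFrobProj I.𝓛
      (I.L₁⁻¹ • lossGrad (I.F (trial k (rej k - 1)) - I.F (z k)) (trial k (rej k - 1) - z k)
        (B (round k)))
      (G (round k))
  /-- projected gradient step with the surrogate gradient; in round `0` and in Case I
  (`γ_t ≤ 1`) the surrogate gradient is `G_t` -/
  W_succ : ∀ k, rej k ≠ 0 → W (round k + 1) =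
    ballProj I.R (W (round k) - I.ρ •
      (if round k = 0 ∨ γ (round k) ≤ 1 then G (round k)
       else G (round k) +
        max 0 (-((γ (round k))⁻¹ * frobInner (G (round k)) (W (round k)))) • S (round k)))
  /-- the oracle output with the larger `γ` is used, and its matrix is projected onto `𝓛` -/
  query : ∀ t, 1 ≤ t →
    ((svd t).1 ≤ (ext t).1 ∧ γ t = (ext t).1 ∧ IsFrobProj I.𝓛 (ext t).2 (S t)) ∨
    ((ext t).1 ≤ (svd t).1 ∧ γ t = (svd t).1 ∧ IsFrobProj I.𝓛 (svd t).2 (S t))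
  /-- Option II: `B_t = L₁ B̂_t + L₁ I` with `B̂_t = W_t / (1 + δ_t)` in Case I and
  `B̂_t = W_t / ((1 + δ_t) γ_t)` in Case II -/
  B_succ : ∀ t, 1 ≤ t → B t =
    I.L₁ • ((if γ t ≤ 1 then (1 + I.δ t)⁻¹ else ((1 + I.δ t) * γ t)⁻¹) • W t) +
      I.L₁ • (1 : Mat d)

namespace Run

variable {I : Input d} (r : Run I)

/-- Accepted step size `η_k`. -/
def η (k : ℕ) : ℝ := r.σ k * I.β ^ r.rej k

/-- Accepted trial point `ẑ_k`. -/
def zhat (k : ℕ) : Vec d := r.trial k (r.rej k)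

/-- Weighted average `z̄_k = (∑_{i<k} η_i ẑ_i) / (∑_{i<k} η_i)`. -/
def avg (k : ℕ) : Vec d :=
  (∑ i ∈ Finset.range k, r.η i)⁻¹ • ∑ i ∈ Finset.range k, r.η i • r.zhat i

/-- Round `t` of the online learner takes place, so that its oracles are called. -/
def Reaches (t : ℕ) : Prop := ∃ k, r.round k = t

end Run

/-! ### Problem classes and gap functions -/

/-- Given the set `X` of coordinates of the minimizing player, `(x, y')` for
`z = (x, y)` and `z' = (x', y')`. -/
def mix (X : Finset (Fin d)) (z z' : Vec d) : Vec d :=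
  WithLp.toLp 2 fun i => if i ∈ X then z i else z' i

/-- Change the sign of the coordinates of the maximizing player. -/
def flipSign (X : Finset (Fin d)) (v : Vec d) : Vec d :=
  WithLp.toLp 2 fun i => if i ∈ X then v i else -v i

/-- The problems that lead to the equation `F z = 0`: the equation itself; minimization of `f`,
where `F = ∇f`; and `min_x max_y f (x, y)`, where `F = (∇_x f, -∇_y f)`. -/
inductive Problem (F : Vec d → Vec d) where
  | equation : Problem F
  | minimization (f : Vec d → ℝ) (hf : ∀ z, HasGradientAt f (F z) z) : Problem F
  | minimax (X : Finset (Fin d)) (f : Vec d → ℝ)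
      (hf : ∀ z, HasGradientAt f (flipSign X (F z)) z) : Problem F

/-- The gap function of each problem. The suprema are maxima when `D` is compact and nonempty and
`F` is continuous. -/
def Problem.gap {F : Vec d → Vec d} (P : Problem F) (D : Set (Vec d)) (z : Vec d) : ℝ :=
  match P with
  | .equation => sSup ((fun z' => ⟪F z', z - z'⟫) '' D)
  | .minimization f _ => sSup ((fun z' => f z - f z') '' D)
  | .minimax X f _ => sSup ((fun z' => f (mix X z z') - f (mix X z' z)) '' D)

/-- `max_{z ∈ D} ‖z₀ - z‖²`. -/
def maxDistSq (z₀ : Vec d) (D : Set (Vec d)) : ℝ := sSup ((fun z => ‖z₀ - z‖ ^ 2) '' D)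

/-! ### Parameters and constants of the theorem -/

/-- `δ_t = 1 / (2 (t+1)^{1/4})`. -/
def delta (t : ℕ) : ℝ := 1 / (2 * ((t : ℝ) + 1) ^ (1 / 4 : ℝ))

/-- `q_t = p / (2.5 (t+1) log² (t+1))`. -/
def failProb (p : ℝ) (t : ℕ) : ℝ := p / (2.5 * ((t : ℝ) + 1) * Real.log ((t : ℝ) + 1) ^ 2)

/-- The constant `C`. -/
def constC (α₁ α₂ β : ℝ) : ℝ :=
  (1 + α₁) ^ 2 / (2 * (1 - α₁) ^ 2 * β ^ 2 * (1 - (α₁ + α₂)))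

/-- The quantity `Q₁`, with solution `zs`. -/
def Q₁ (I : Input d) (L₂ : ℝ) (zs : Vec d) : ℝ :=
  9 * Real.sqrt 2 * (frobNorm (I.B₀ - jac I.F I.z₀) / I.L₁) +
    Real.sqrt (2 * constC I.α₁ I.α₂ I.β) * (L₂ * ‖I.z₀ - zs‖ / I.L₁)

/-- The quantity `Q₂`, with solution `zs`. -/
def Q₂ (I : Input d) (L₂ : ℝ) (zs : Vec d) : ℝ :=
  Real.sqrt (648 * Real.sqrt 2 * d * L₂ * ‖I.z₀ - zs‖ /
    (Real.sqrt (1 - I.α₁ - I.α₂) * I.L₁)) + 6 * Real.sqrt 2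

end QNPE

end

/-!
The method is a proximal extragradient method whose step sizes are governed by an online learner
that approximates the Jacobian.

Extragradient part. An accepted pair `(η_k, ẑ_k)` satisfies `Run.extragradient_step`, so the
distances to a zero decrease, the sum of `‖ẑ_k - z_k‖ ^ 2` is bounded by a multiple of `‖z₀ - z*‖
^ 2`, and the weighted linearized gaps telescope. By `Problem.gapFun_spec` every gap function is
convex and dominated by the linearized gap, hence `Gap ≤ M / (2 ∑ η_i)`, and it remains to bound
`∑ 1 / η_i` from above. Since steps grow by the factor `1 / β` when the line search accepts at
once, only backtracking iterations count (`Run.sum_inv_η_le`). At such an iteration the rejected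
trial point shows that `1 / η_k` is at most a multiple of the square root of the loss of the
played matrix (`Run.inv_η_le_playedRes`). That loss is always bounded, because the oracles keep
the played matrix in a bounded set; this gives the `1 / k` rate.

Learner part. For the faster rate the sum of the losses is bounded by the dynamic regret with the
Jacobians `∇F(z_k)` as moving comparator, in the coordinates in which the feasible set is `setC`.
The surrogate gradient has norm at most eleven times the square root of the normalized loss, so
with step size `1 / 121` one projected step decreases the squared distance to the comparator by a
multiple of the loss, up to the loss of the comparator and the oracle accuracy (`surrogate_step`,
`learner_step`). The loss of the comparator is a Taylor remainder, of order `‖ẑ_k - z_k‖ ^ 2`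
because inexact solutions for neighbouring step sizes are comparable (`norm_solution_le`); the
terms `δ_t ^ 2` sum to at most `√k / 2`; and the motion of the comparator costs at most `4 R √d L₂
/ L₁` times the path length of `z_k`, which is of order `√k ‖z₀ - z*‖`. Summing
(`Run.potential_succ_le`) and applying the Cauchy-Schwarz inequality bounds `∑ 1 / η_i` by `L₁ /
((1 - β) α₂ β)` times `5 + Q₁ √k + Q₂ k ^ (3 / 4)`.

Probability enters only through a union bound: the failure probabilities sum to at most `p`
(`sum_failProb_le`), and the estimates are deterministic on the event that every oracle call
succeeds.
-/

namespace QNPE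

variable {d : ℕ}

/-! ### Frobenius geometry of matrices -/

/-- A matrix as the vector of its entries. This isometry from the Frobenius to the Euclidean inner
product makes the inner product space library available for matrices. -/
noncomputable def toVec {d : ℕ} : Mat d →ₗ[ℝ] EuclideanSpace ℝ (Fin d × Fin d) where
  toFun A := WithLp.toLp 2 fun p => A p.1 p.2
  map_add' _ _ := rfl
  map_smul' _ _ := rfl

theorem frobInner_eq (A B : Mat d) : frobInner A B = ⟪toVec A, toVec B⟫ := by
  rw [PiLp.inner_apply, Fintype.sum_prod_type]
  exact Finset.sum_congr rfl fun i _ => Finset.sum_congr rfl fun j _ => mul_comm _ _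

theorem frobNorm_eq (A : Mat d) : frobNorm A = ‖toVec A‖ := by
  rw [frobNorm, frobInner_eq, real_inner_self_eq_norm_sq, Real.sqrt_sq (norm_nonneg _)]

theorem mv_apply (A : Mat d) (v : Vec d) (i : Fin d) : mv A v i = ∑ j, A i j * v j := rfl

@[simp] theorem mv_add (A B : Mat d) (v : Vec d) : mv (A + B) v = mv A v + mv B v := by
  simp [mv, map_add]

@[simp] theorem mv_sub (A B : Mat d) (v : Vec d) : mv (A - B) v = mv A v - mv B v := by
  simp [mv, map_sub]

@[simp] theorem mv_smul (c : ℝ) (A : Mat d) (v : Vec d) : mv (c • A) v = c • mv A v := by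
  simp [mv, map_smul]

@[simp] theorem mv_one (v : Vec d) : mv (1 : Mat d) v = v := by
  simp [mv]

@[simp] theorem mv_vec_sub (A : Mat d) (v w : Vec d) : mv A (v - w) = mv A v - mv A w := by
  simp [mv, map_sub]

theorem norm_mv_le (A : Mat d) (v : Vec d) : ‖mv A v‖ ≤ opNorm A * ‖v‖ :=
  ContinuousLinearMap.le_opNorm _ _

theorem opNorm_le_of {A : Mat d} {c : ℝ} (hc : 0 ≤ c) (h : ∀ v, ‖mv A v‖ ≤ c * ‖v‖) :
    opNorm A ≤ c :=
  ContinuousLinearMap.opNorm_le_bound _ hc h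

theorem opNorm_nonneg (A : Mat d) : 0 ≤ opNorm A := norm_nonneg _

theorem opNorm_smul (c : ℝ) (A : Mat d) : opNorm (c • A) = |c| * opNorm A := by
  simp [opNorm, map_smul, norm_smul]

theorem opNorm_add_le (A B : Mat d) : opNorm (A + B) ≤ opNorm A + opNorm B := by
  simp only [opNorm, map_add]; exact norm_add_le _ _

theorem opNorm_sub_le (A B : Mat d) : opNorm (A - B) ≤ opNorm A + opNorm B := by
  simp only [opNorm, map_sub]; exact norm_sub_le _ _

theorem opNorm_one_le : opNorm (1 : Mat d) ≤ 1 :=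
  opNorm_le_of zero_le_one fun v => by simp

theorem frobNorm_le_sqrt_mul_opNorm (A : Mat d) : frobNorm A ≤ Real.sqrt d * opNorm A := by
  rw [frobNorm]
  apply Real.sqrt_le_iff.mpr ⟨mul_nonneg (Real.sqrt_nonneg _) (opNorm_nonneg A), ?_⟩
  rw [mul_pow, Real.sq_sqrt (Nat.cast_nonneg d), frobInner, Finset.sum_comm]
  calc ∑ j, ∑ i, A i j * A i j = ∑ j : Fin d, ‖mv A (EuclideanSpace.single j 1)‖ ^ 2 := by
        refine Finset.sum_congr rfl fun j _ => ?_
        rw [EuclideanSpace.norm_sq_eq]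
        refine Finset.sum_congr rfl fun i _ => ?_
        simp [mv_apply, sq]
    _ ≤ ∑ _j : Fin d, opNorm A ^ 2 := by
        refine Finset.sum_le_sum fun j _ => ?_
        have := norm_mv_le A (EuclideanSpace.single j 1)
        simp only [PiLp.norm_single, norm_one, mul_one] at this
        gcongr
    _ = d * opNorm A ^ 2 := by simp

theorem inner_mv_symPart (A : Mat d) (v : Vec d) : ⟪mv (symPart A) v, v⟫ = ⟪mv A v, v⟫ := by
  have h : ⟪mv A.transpose v, v⟫ = ⟪mv A v, v⟫ := by
    simp only [PiLp.inner_apply, mv_apply, RCLike.inner_apply, conj_trivial, Finset.mul_sum,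
      Matrix.transpose_apply]
    rw [Finset.sum_comm]
    exact Finset.sum_congr rfl fun i _ => Finset.sum_congr rfl fun j _ => by ring
  simp only [symPart, mv_smul, mv_add, inner_smul_left, inner_add_left, h]
  simp only [conj_trivial]; ring

theorem isHermitian_symPart (A : Mat d) : (symPart A).IsHermitian := by
  ext i j; simp [symPart]; ring

theorem loewnerLE_iff {A B : Mat d} (hA : A.IsHermitian) (hB : B.IsHermitian) :
    LoewnerLE A B ↔ ∀ v, ⟪mv A v, v⟫ ≤ ⟪mv B v, v⟫ := by
  have key : ∀ v : Vec d, star v.ofLp ⬝ᵥ Matrix.mulVec (B - A) v.ofLp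
      = ⟪mv B v, v⟫ - ⟪mv A v, v⟫ := by
    intro v
    rw [← inner_sub_left, ← mv_sub, PiLp.inner_apply]
    simp only [dotProduct, Matrix.mulVec, mv_apply, RCLike.inner_apply, conj_trivial, star_trivial]
  rw [LoewnerLE, Matrix.posSemidef_iff_dotProduct_mulVec]
  constructor
  · intro h v
    have := h.2 v.ofLp
    rw [key] at this
    linarith
  · intro h
    refine ⟨hB.sub hA, fun x => ?_⟩
    have := key (WithLp.toLp 2 x)
    simp only at this
    rw [this]
    linarith [h (WithLp.toLp 2 x)]

theorem isHermitian_smul_one (c : ℝ) : (c • (1 : Mat d)).IsHermitian := by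
  ext i j; simp [Matrix.one_apply, eq_comm]

theorem symPart_le_smul_one_iff {A : Mat d} {c : ℝ} :
    LoewnerLE (symPart A) (c • (1 : Mat d)) ↔ ∀ v, ⟪mv A v, v⟫ ≤ c * ‖v‖ ^ 2 := by
  rw [loewnerLE_iff (isHermitian_symPart A) (isHermitian_smul_one c)]
  simp [inner_mv_symPart, inner_smul_left]

theorem smul_one_le_symPart_iff {A : Mat d} {c : ℝ} :
    LoewnerLE (c • (1 : Mat d)) (symPart A) ↔ ∀ v, c * ‖v‖ ^ 2 ≤ ⟪mv A v, v⟫ := by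
  rw [loewnerLE_iff (isHermitian_smul_one c) (isHermitian_symPart A)]
  simp [inner_mv_symPart, inner_smul_left]

theorem zero_le_symPart_iff {A : Mat d} :
    LoewnerLE 0 (symPart A) ↔ ∀ v, 0 ≤ ⟪mv A v, v⟫ := by
  simpa using smul_one_le_symPart_iff (A := A) (c := 0)

theorem mem_setC_iff {𝓛 : Submodule ℝ (Mat d)} {A : Mat d} :
    A ∈ setC 𝓛 ↔ (∀ v, |⟪mv A v, v⟫| ≤ ‖v‖ ^ 2) ∧ opNorm A ≤ 3 ∧ A ∈ 𝓛 := by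
  have h1 := symPart_le_smul_one_iff (A := A) (c := 1)
  have h2 := smul_one_le_symPart_iff (A := A) (c := -1)
  simp only [one_smul, neg_smul, one_mul, neg_mul] at h1 h2
  simp only [setC, Set.mem_ofPred_eq, h1, h2, abs_le]
  constructor
  · rintro ⟨a, b, c, e⟩; exact ⟨fun v => ⟨a v, b v⟩, c, e⟩
  · rintro ⟨a, c, e⟩; exact ⟨fun v => (a v).1, fun v => (a v).2, c, e⟩

theorem frobInner_lossGrad (u s : Vec d) (B H : Mat d) :
    frobInner (lossGrad u s B) H = -2 * ⟪u - mv B s, mv H s⟫ / ‖s‖ ^ 2 := by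
  rw [PiLp.inner_apply]
  simp only [frobInner, lossGrad, Matrix.of_apply, mv_apply, RCLike.inner_apply, conj_trivial,
    Finset.sum_mul, Finset.mul_sum, Finset.sum_div]
  exact Finset.sum_congr rfl fun i _ => Finset.sum_congr rfl fun j _ => by ring

theorem frobNorm_lossGrad {u s : Vec d} (hs : s ≠ 0) (B : Mat d) :
    frobNorm (lossGrad u s B) = 2 * (‖u - mv B s‖ / ‖s‖) := by
  have hs' : ‖s‖ ≠ 0 := norm_ne_zero_iff.mpr hs
  have h : frobInner (lossGrad u s B) (lossGrad u s B) = (2 * (‖u - mv B s‖ / ‖s‖)) ^ 2 := by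
    have e : ∀ i, mv (lossGrad u s B) s i = -2 * (u - mv B s) i := by
      intro i
      simp only [mv_apply, lossGrad, Matrix.of_apply]
      have : ∀ j, -2 * (u - mv B s) i * s j / ‖s‖ ^ 2 * s j
          = -2 * (u - mv B s) i / ‖s‖ ^ 2 * ‖s j‖ ^ 2 := by
        intro j; rw [Real.norm_eq_abs, sq_abs]; ring
      simp only [this]
      rw [← Finset.mul_sum, ← EuclideanSpace.norm_sq_eq]
      field_simp
    have e' : mv (lossGrad u s B) s = (-2 : ℝ) • (u - mv B s) := by
      ext i; rw [e]; simp
    rw [frobInner_lossGrad, e', inner_smul_right, real_inner_self_eq_norm_sq]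
    field_simp
  rw [frobNorm, h, Real.sqrt_sq (by positivity)]

section Projections

variable {V : Type*} [NormedAddCommGroup V] [InnerProductSpace ℝ V]

/-- The radial projection onto a ball does not increase the distance to points of the ball. -/
theorem norm_radial_sub_le {R : ℝ} (hR : 0 ≤ R) (w x : V) (hx : ‖x‖ ≤ R) :
    ‖(R / max R ‖w‖) • w - x‖ ≤ ‖w - x‖ := by
  rcases le_or_gt ‖w‖ R with hw | hw
  · rw [max_eq_left hw]
    rcases hR.eq_or_lt with h0 | h0
    · have : w = 0 := norm_le_zero_iff.mp (by linarith)
      simp [this]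
    · rw [div_self h0.ne', one_smul]
  · rw [max_eq_right hw.le]
    have hw0 : 0 < ‖w‖ := hR.trans_lt hw
    set t := R / ‖w‖ with ht
    have htw : t * ‖w‖ = R := by rw [ht]; field_simp
    have ht1 : t ≤ 1 := (div_le_one hw0).mpr hw.le
    have ht0 : 0 ≤ t := by positivity
    apply le_of_sq_le_sq _ (norm_nonneg _)
    rw [norm_sub_sq_real, norm_sub_sq_real, norm_smul, inner_smul_left, Real.norm_of_nonneg ht0]
    simp only [conj_trivial]
    have h1 : ⟪w, x⟫ ≤ ‖w‖ * R := (real_inner_le_norm w x).trans (by gcongr)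
    have h2 : 0 ≤ (1 - t) * ((1 + t) * ‖w‖ ^ 2 - 2 * ⟪w, x⟫) := by
      apply mul_nonneg (by linarith)
      nlinarith
    nlinarith

end Projections

theorem frobNorm_ballProj_le {R : ℝ} (hR : 0 ≤ R) (A : Mat d) : frobNorm (ballProj R A) ≤ R := by
  rw [ballProj, frobNorm_eq, map_smul, frobNorm_eq, norm_smul, Real.norm_of_nonneg (by positivity)]
  rcases hR.eq_or_lt with h0 | h0
  · simp [← h0]
  · rw [div_mul_eq_mul_div]
    exact div_le_of_le_mul₀ (by positivity) hR (by gcongr; exact le_max_right _ _)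

theorem toVec_ballProj (R : ℝ) (A : Mat d) :
    toVec (ballProj R A) = (R / max R ‖toVec A‖) • toVec A := by
  rw [ballProj, map_smul, frobNorm_eq]

theorem IsFrobProj.inner_eq {𝓛 : Submodule ℝ (Mat d)} {A PA B : Mat d} (h : IsFrobProj 𝓛 A PA)
    (hB : B ∈ 𝓛) : frobInner PA B = frobInner A B := by
  have := h.2 B hB
  rw [frobInner_eq, map_sub, inner_sub_left] at this
  rw [frobInner_eq, frobInner_eq]; linarith

theorem IsFrobProj.norm_le {𝓛 : Submodule ℝ (Mat d)} {A PA : Mat d} (h : IsFrobProj 𝓛 A PA) :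
    frobNorm PA ≤ frobNorm A := by
  have := h.inner_eq h.1
  rw [frobInner_eq, frobInner_eq, real_inner_self_eq_norm_sq] at this
  rw [frobNorm_eq, frobNorm_eq]
  have h2 := real_inner_le_norm (toVec A) (toVec PA)
  by_contra! hlt
  have : 0 < ‖toVec PA‖ := (norm_nonneg _).trans_lt hlt
  nlinarith

/-! ### Monotone operators and their Jacobians -/

theorem mv_jac (F : Vec d → Vec d) (z v : Vec d) : mv (jac F z) v = fderiv ℝ F z v := by
  simp [mv, jac]

theorem opNorm_jac (F : Vec d → Vec d) (z : Vec d) : opNorm (jac F z) = ‖fderiv ℝ F z‖ := by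
  simp [opNorm, jac]

theorem hasDerivAt_add_smul (z v : Vec d) (t : ℝ) :
    HasDerivAt (fun τ : ℝ => z + τ • v) v t := by
  simpa using ((hasDerivAt_id t).smul_const v).const_add z

theorem hasDerivAt_comp_add_smul {F : Vec d → Vec d} (hF : Differentiable ℝ F) (z v : Vec d)
    (t : ℝ) : HasDerivAt (fun τ : ℝ => F (z + τ • v)) (fderiv ℝ F (z + t • v) v) t :=
  (hF (z + t • v)).hasFDerivAt.comp_hasDerivAt t (hasDerivAt_add_smul z v t)

theorem inner_fderiv_nonneg {F : Vec d → Vec d} (hF : Differentiable ℝ F)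
    (hmono : ∀ z z', 0 ≤ ⟪F z - F z', z - z'⟫) (z v : Vec d) : 0 ≤ ⟪fderiv ℝ F z v, v⟫ := by
  have h1 : HasDerivAt (fun τ : ℝ => ⟪F (z + τ • v), v⟫) ⟪fderiv ℝ F z v, v⟫ 0 := by
    have := (hasDerivAt_comp_add_smul hF z v 0).inner ℝ (hasDerivAt_const (0 : ℝ) v)
    simpa using this
  have h2 : Monotone (fun τ : ℝ => ⟪F (z + τ • v), v⟫) := by
    intro a b hab
    rcases hab.eq_or_lt with rfl | hlt
    · exact le_rfl
    · have := hmono (z + b • v) (z + a • v)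
      rw [add_sub_add_left_eq_sub, ← sub_smul, inner_smul_right, inner_sub_left] at this
      have := nonneg_of_mul_nonneg_right this (sub_pos.mpr hlt)
      simp only; linarith
  rw [← h1.deriv]
  exact h2.deriv_nonneg

theorem opNorm_jac_le {F : Vec d → Vec d} {L : ℝ} (hL : 0 < L)
    (hlip : ∀ z z', ‖F z - F z'‖ ≤ L * ‖z - z'‖) (z : Vec d) : opNorm (jac F z) ≤ L := by
  rw [opNorm_jac]
  have : LipschitzWith ⟨L, hL.le⟩ F := LipschitzWith.of_dist_le_mul fun x y => by
    rw [dist_eq_norm, dist_eq_norm]; exact hlip x y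
  exact norm_fderiv_le_of_lipschitz ℝ this

/-- First-order Taylor estimate for an operator with Lipschitz derivative. -/
theorem norm_taylor_le {F : Vec d → Vec d} {L : ℝ} (hF : Differentiable ℝ F)
    (hlip : ∀ z z', ‖fderiv ℝ F z - fderiv ℝ F z'‖ ≤ L * ‖z - z'‖) (z s : Vec d) :
    ‖F (z + s) - F z - fderiv ℝ F z s‖ ≤ L / 2 * ‖s‖ ^ 2 := by
  have hder : ∀ t : ℝ, HasDerivAt (fun τ : ℝ => F (z + τ • s) - F z - τ • fderiv ℝ F z s)
      (fderiv ℝ F (z + t • s) s - fderiv ℝ F z s) t := by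
    intro t
    have h2 := (hasDerivAt_id t).smul_const (fderiv ℝ F z s)
    rw [one_smul] at h2
    exact ((hasDerivAt_comp_add_smul hF z s t).sub_const (F z)).sub h2
  have hB : ∀ t : ℝ, HasDerivAt (fun τ : ℝ => L / 2 * ‖s‖ ^ 2 * τ ^ 2) (L * ‖s‖ ^ 2 * t) t := by
    intro t
    have := ((hasDerivAt_id t).pow 2).const_mul (L / 2 * ‖s‖ ^ 2)
    refine this.congr_deriv ?_
    simp; ring
  have := image_norm_le_of_norm_deriv_right_le_deriv_boundary (a := 0) (b := 1)
    (f := fun τ : ℝ => F (z + τ • s) - F z - τ • fderiv ℝ F z s)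
    (fun t _ => (hder t).continuousAt.continuousWithinAt)
    (fun t _ => (hder t).hasDerivWithinAt) (B := fun τ : ℝ => L / 2 * ‖s‖ ^ 2 * τ ^ 2) (by simp) hB
    (fun t ht => by
      have h1 := hlip (z + t • s) z
      rw [add_sub_cancel_left, norm_smul, Real.norm_of_nonneg ht.1] at h1
      calc ‖fderiv ℝ F (z + t • s) s - fderiv ℝ F z s‖
          = ‖(fderiv ℝ F (z + t • s) - fderiv ℝ F z) s‖ := by simp
        _ ≤ ‖fderiv ℝ F (z + t • s) - fderiv ℝ F z‖ * ‖s‖ := ContinuousLinearMap.le_opNorm _ _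
        _ ≤ L * (t * ‖s‖) * ‖s‖ := by gcongr
        _ = L * ‖s‖ ^ 2 * t := by ring)
    (x := 1) (by simp)
  simpa using this

/-- The change of variables `B ↦ (B - L I) / L` that carries `setZ` into `setC`. -/
noncomputable def centered (L : ℝ) (B : Mat d) : Mat d := L⁻¹ • (B - L • (1 : Mat d))

theorem smul_centered_add {L : ℝ} (hL : L ≠ 0) (B : Mat d) :
    L • centered L B + L • (1 : Mat d) = B := by
  rw [centered, smul_smul, mul_inv_cancel₀ hL, one_smul, sub_add_cancel]

theorem centered_mem_setC {𝓛 : Submodule ℝ (Mat d)} {L : ℝ} (hL : 0 < L) {B : Mat d}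
    (h1 : (1 : Mat d) ∈ 𝓛) (hB : B ∈ 𝓛) (hpos : ∀ v, 0 ≤ ⟪mv B v, v⟫) (hop : opNorm B ≤ L) :
    centered L B ∈ setC 𝓛 := by
  rw [mem_setC_iff]
  refine ⟨fun v => ?_, ?_, 𝓛.smul_mem _ (𝓛.sub_mem hB (𝓛.smul_mem _ h1))⟩
  · have h2 : ⟪mv B v, v⟫ ≤ L * ‖v‖ ^ 2 := by
      calc ⟪mv B v, v⟫ ≤ ‖mv B v‖ * ‖v‖ := real_inner_le_norm _ _
        _ ≤ L * ‖v‖ * ‖v‖ := by gcongr; exact (norm_mv_le B v).trans (by gcongr)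
        _ = L * ‖v‖ ^ 2 := by ring
    have h3 : ⟪mv (centered L B) v, v⟫ = L⁻¹ * ⟪mv B v, v⟫ - ‖v‖ ^ 2 := by
      simp only [centered, mv_smul, mv_sub, mv_one, inner_smul_left, inner_sub_left, conj_trivial,
        real_inner_self_eq_norm_sq]
      field_simp
    have h4 : L⁻¹ * ⟪mv B v, v⟫ ≤ ‖v‖ ^ 2 := by
      rw [inv_mul_le_iff₀ hL]; exact h2
    have h5 : 0 ≤ L⁻¹ * ⟪mv B v, v⟫ := mul_nonneg (by positivity) (hpos v)
    rw [h3, abs_le]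
    constructor <;> nlinarith [sq_nonneg ‖v‖]
  · rw [centered, opNorm_smul, abs_of_pos (inv_pos.mpr hL), inv_mul_le_iff₀ hL]
    have h3 : opNorm (L • (1 : Mat d)) ≤ L := by
      rw [opNorm_smul, abs_of_pos hL]
      nlinarith [opNorm_one_le (d := d)]
    linarith [opNorm_sub_le B (L • (1 : Mat d))]

theorem frobNorm_centered_sub_le {L : ℝ} (hL : 0 < L) (A B : Mat d) :
    ‖toVec (centered L A) - toVec (centered L B)‖ ≤ Real.sqrt d * (opNorm (A - B) / L) := by
  rw [← map_sub, ← frobNorm_eq]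
  have : centered L A - centered L B = L⁻¹ • (A - B) := by
    simp only [centered, ← smul_sub]; congr 1; abel
  refine (frobNorm_le_sqrt_mul_opNorm _).trans (le_of_eq ?_)
  rw [this, opNorm_smul, abs_of_pos (inv_pos.mpr hL)]; ring

/-! ### Gap functions -/

/-- The function maximized over `z'` in the gap at `z`. -/
noncomputable def Problem.gapFun {F : Vec d → Vec d} (P : Problem F) (z z' : Vec d) : ℝ :=
  match P with
  | .equation => ⟪F z', z - z'⟫
  | .minimization f _ => f z - f z'
  | .minimax X f _ => f (mix X z z') - f (mix X z' z)

theorem Problem.gap_eq {F : Vec d → Vec d} (P : Problem F) (D : Set (Vec d)) (z : Vec d) :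
    P.gap D z = sSup (P.gapFun z '' D) := by
  cases P <;> rfl

theorem flipSign_compl (X : Finset (Fin d)) (v : Vec d) : flipSign Xᶜ v = -flipSign X v := by
  ext i; by_cases h : i ∈ X <;> simp [flipSign, h]

theorem inner_flipSign {X : Finset (Fin d)} {w : Vec d} (hw : ∀ i, i ∉ X → w i = 0) (v : Vec d) :
    ⟪flipSign X v, w⟫ = ⟪v, w⟫ := by
  rw [PiLp.inner_apply, PiLp.inner_apply]
  refine Finset.sum_congr rfl fun i _ => ?_
  by_cases h : i ∈ X
  · simp [flipSign, h]
  · simp [hw i h]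

/-- Gradient inequality in the coordinates of the minimizing player. -/
theorem add_inner_le_of_support {F : Vec d → Vec d} {X : Finset (Fin d)} {f : Vec d → ℝ}
    (hmono : ∀ z z', 0 ≤ ⟪F z - F z', z - z'⟫)
    (hf : ∀ z, HasGradientAt f (flipSign X (F z)) z) (z : Vec d) {w : Vec d}
    (hw : ∀ i, i ∉ X → w i = 0) : f z + ⟪F z, w⟫ ≤ f (z + w) := by
  have hder : ∀ t : ℝ, HasDerivAt (fun τ : ℝ => f (z + τ • w)) ⟪F (z + t • w), w⟫ t := by
    intro t
    have := (hf (z + t • w)).hasFDerivAt.comp_hasDerivAt t (hasDerivAt_add_smul z w t)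
    exact this.congr_deriv (by simp [inner_flipSign hw])
  obtain ⟨t, ht, h⟩ := exists_hasDerivAt_eq_slope (fun τ : ℝ => f (z + τ • w))
    (fun t => ⟪F (z + t • w), w⟫) zero_lt_one
    (fun t _ => (hder t).continuousAt.continuousWithinAt) (fun t _ => hder t)
  have h2 := hmono (z + t • w) z
  rw [add_sub_cancel_left, inner_smul_right, inner_sub_left] at h2
  have h3 := nonneg_of_mul_nonneg_right h2 ht.1
  simp at h
  linarith

theorem le_sub_inner_of_support {F : Vec d → Vec d} {X : Finset (Fin d)} {f : Vec d → ℝ}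
    (hmono : ∀ z z', 0 ≤ ⟪F z - F z', z - z'⟫)
    (hf : ∀ z, HasGradientAt f (flipSign X (F z)) z) (z : Vec d) {w : Vec d}
    (hw : ∀ i, i ∈ X → w i = 0) : f (z + w) ≤ f z - ⟪F z, w⟫ := by
  have hf' : ∀ z, HasGradientAt (fun z => -f z) (flipSign Xᶜ (F z)) z := by
    intro z
    rw [flipSign_compl, hasGradientAt_iff_hasFDerivAt, map_neg]
    exact (hf z).hasFDerivAt.neg
  have := add_inner_le_of_support hmono hf' z (w := w) (by simpa using hw)
  linarith

theorem mix_sub_mix_left (X : Finset (Fin d)) (p c z : Vec d) :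
    mix X p z = mix X c z + mix X (p - c) 0 := by
  ext i; by_cases h : i ∈ X <;> simp [mix, h]

theorem mix_sub_mix_right (X : Finset (Fin d)) (p c z : Vec d) :
    mix X z p = mix X z c + mix X 0 (p - c) := by
  ext i; by_cases h : i ∈ X <;> simp [mix, h]

theorem mix_self (X : Finset (Fin d)) (p : Vec d) : mix X p p = p := by
  ext i; simp [mix]

theorem inner_mix_add (X : Finset (Fin d)) (a b v : Vec d) :
    ⟪a, mix X v 0⟫ + ⟪b, mix X 0 v⟫ = ⟪mix X a b, v⟫ := by
  simp only [PiLp.inner_apply, ← Finset.sum_add_distrib]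
  refine Finset.sum_congr rfl fun i _ => ?_
  by_cases h : i ∈ X <;> simp [mix, h]

theorem minimax_gapFun_spec {F : Vec d → Vec d} (hmono : ∀ z z', 0 ≤ ⟪F z - F z', z - z'⟫)
    (X : Finset (Fin d)) (f : Vec d → ℝ) (hf : ∀ z, HasGradientAt f (flipSign X (F z)) z) :
    (∀ c z', ∃ g : Vec d, ∀ p, (f (mix X c z') - f (mix X z' c)) + ⟪g, p - c⟫
      ≤ f (mix X p z') - f (mix X z' p)) ∧
    ∀ p z', f (mix X p z') - f (mix X z' p) ≤ ⟪F p, p - z'⟫ := by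
  have hX : ∀ v : Vec d, ∀ i, i ∉ X → mix X v 0 i = 0 := fun v i hi => by simp [mix, hi]
  have hY : ∀ v : Vec d, ∀ i, i ∈ X → mix X 0 v i = 0 := fun v i hi => by simp [mix, hi]
  constructor
  · intro c z'
    refine ⟨mix X (F (mix X c z')) (F (mix X z' c)), fun p => ?_⟩
    have h1 := add_inner_le_of_support hmono hf (mix X c z') (hX (p - c))
    have h2 := le_sub_inner_of_support hmono hf (mix X z' c) (hY (p - c))
    rw [← mix_sub_mix_left] at h1
    rw [← mix_sub_mix_right] at h2
    rw [← inner_mix_add]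
    linarith
  · intro p z'
    have h1 := add_inner_le_of_support hmono hf p (hX (z' - p))
    have h2 := le_sub_inner_of_support hmono hf p (hY (z' - p))
    have e1 := mix_sub_mix_left X z' p p
    have e2 := mix_sub_mix_right X z' p p
    rw [mix_self] at e1 e2
    rw [← e1] at h1
    rw [← e2] at h2
    have h3 := inner_mix_add X (F p) (F p) (z' - p)
    rw [mix_self] at h3
    have h4 : ⟪F p, p - z'⟫ = -⟪F p, z' - p⟫ := by rw [← inner_neg_right, neg_sub]
    linarith

/-- In each problem class the gap function is convex in its first argument, in the form of a
supporting affine function at `c`, and dominated by the linearized gap `⟪F p, p - z'⟫`.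
Minimization is the min-max problem in which the maximizing player has no coordinates. -/
theorem Problem.gapFun_spec {F : Vec d → Vec d} (hmono : ∀ z z', 0 ≤ ⟪F z - F z', z - z'⟫)
    (P : Problem F) :
    (∀ c z', ∃ g : Vec d, ∀ p, P.gapFun c z' + ⟪g, p - c⟫ ≤ P.gapFun p z') ∧
    ∀ p z', P.gapFun p z' ≤ ⟪F p, p - z'⟫ := by
  cases P with
  | equation =>
    refine ⟨fun c z' => ⟨F z', fun p => ?_⟩, fun p z' => ?_⟩
    · simp only [Problem.gapFun]
      rw [← inner_add_right]; simp
    · have := hmono p z'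
      rw [inner_sub_left] at this
      simp only [Problem.gapFun]; linarith
  | minimization f hf =>
    have h1 : ∀ v : Vec d, flipSign Finset.univ v = v := fun v => by ext i; simp [flipSign]
    have h2 : ∀ v w : Vec d, mix Finset.univ v w = v := fun v w => by ext i; simp [mix]
    have := minimax_gapFun_spec hmono Finset.univ f (by simpa only [h1] using hf)
    simp only [h2] at this
    exact this
  | minimax X f hf => exact minimax_gapFun_spec hmono X f hf

/-- A bound on the weighted linearized gaps of points `p i` bounds the gap of their weighted
average. -/
theorem Problem.gap_average_le {F : Vec d → Vec d} (hmono : ∀ z z', 0 ≤ ⟪F z - F z', z - z'⟫)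
    (P : Problem F) {D : Set (Vec d)} (hD : IsCompact D) (hne : D.Nonempty) (z₀ : Vec d)
    (s : Finset ℕ) (w : ℕ → ℝ) (p : ℕ → Vec d) (hw : ∀ i ∈ s, 0 ≤ w i)
    (hpos : 0 < ∑ i ∈ s, w i)
    (h : ∀ z', ∑ i ∈ s, w i * ⟪F (p i), p i - z'⟫ ≤ ‖z₀ - z'‖ ^ 2 / 2) :
    P.gap D ((∑ i ∈ s, w i)⁻¹ • ∑ i ∈ s, w i • p i) ≤ maxDistSq z₀ D / (2 * ∑ i ∈ s, w i) := by
  obtain ⟨hconv, hle⟩ := P.gapFun_spec hmono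
  set S := ∑ i ∈ s, w i with hS
  set c := S⁻¹ • ∑ i ∈ s, w i • p i with hc
  rw [Problem.gap_eq]
  refine csSup_le (hne.image _) ?_
  rintro _ ⟨z', hz', rfl⟩
  have hM : ‖z₀ - z'‖ ^ 2 ≤ maxDistSq z₀ D := by
    refine le_csSup ?_ ⟨z', hz', rfl⟩
    exact (hD.image (by fun_prop)).bddAbove
  obtain ⟨g, hg⟩ := hconv c z'
  have h1 : S * P.gapFun c z' ≤ ∑ i ∈ s, w i * P.gapFun (p i) z' := by
    have h2 : ∑ i ∈ s, w i * ⟪g, p i - c⟫ = 0 := by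
      simp only [← inner_smul_right, ← inner_sum, smul_sub, Finset.sum_sub_distrib,
        ← Finset.sum_smul]
      rw [← hS, hc, smul_smul, mul_inv_cancel₀ hpos.ne', one_smul, sub_self, inner_zero_right]
    calc S * P.gapFun c z' = ∑ i ∈ s, w i * (P.gapFun c z' + ⟪g, p i - c⟫) := by
          simp only [mul_add, Finset.sum_add_distrib, h2, ← Finset.sum_mul, add_zero, hS]
      _ ≤ _ := Finset.sum_le_sum fun i hi => mul_le_mul_of_nonneg_left (hg _) (hw i hi)
  have h3 : ∑ i ∈ s, w i * P.gapFun (p i) z' ≤ ∑ i ∈ s, w i * ⟪F (p i), p i - z'⟫ :=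
    Finset.sum_le_sum fun i hi => mul_le_mul_of_nonneg_left (hle _ _) (hw i hi)
  rw [le_div_iff₀ (by positivity)]
  linarith [h z']

/-! ### One step of the online learner -/

/-- One unprojected step of the learner with step size `1 / 121`. Here `w` is the auxiliary iterate,
`x` the comparator, `a` and `b` are the normalized residuals of the played point
`((1 + θ) m)⁻¹ • w` and of `x`, and `G` is the surrogate gradient. Since `‖G‖ ≤ 2a + 9a = 11a`, the
quadratic term of the step is at most `a ^ 2 / 121`. -/
theorem surrogate_step {V : Type*} [NormedAddCommGroup V] [InnerProductSpace ℝ V]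
    {w x g S G : V} {a b m θ : ℝ} (hm : 1 ≤ m) (hθ0 : 0 ≤ θ) (hθ : θ ≤ 1 / 2) (ha : 0 ≤ a)
    (hg : ‖g‖ ≤ 2 * a) (hgw : |⟪g, w⟫| ≤ 2 * a * (3 * ((1 + θ) * m)))
    (hloc : 2 * a ^ 2 - 2 * a * b ≤ ⟪g, ((1 + θ) * m)⁻¹ • w - x⟫)
    (hG : (m = 1 ∧ G = g) ∨ (‖S‖ ≤ 1 ∧ m - 1 ≤ ⟪S, w - x⟫ ∧
      G = g + max 0 (-(m⁻¹ * ⟪g, w⟫)) • S)) :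
    121 * ‖w - (1 / 121 : ℝ) • G - x‖ ^ 2 ≤
      121 * ‖w - x‖ ^ 2 - (3 * a ^ 2 - 4 * a * b - 12 * θ * a) := by
  have hm0 : 0 < m := by linarith
  set κ := ((1 + θ) * m)⁻¹ with hκ
  have hκm : m⁻¹ = (1 + θ) * κ := by rw [hκ]; field_simp
  have hκ0 : 0 < κ := by rw [hκ]; positivity
  have hκw : |κ * ⟪g, w⟫| ≤ 6 * a := by
    rw [abs_mul, abs_of_pos hκ0, hκ, inv_mul_le_iff₀ (by positivity)]
    linarith
  rw [abs_le] at hκw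
  -- linear part: the surrogate dominates the true gradient at `w / m`
  have hlin0 : m⁻¹ * ⟪g, w⟫ - ⟪g, x⟫ ≤ ⟪G, w - x⟫ := by
    rcases hG with ⟨rfl, rfl⟩ | ⟨-, h2, rfl⟩
    · rw [inner_sub_right]; simp
    · rw [inner_add_left, inner_smul_left, inner_sub_right]
      simp only [conj_trivial]
      rcases le_total 0 (m⁻¹ * ⟪g, w⟫) with h | h
      · rw [max_eq_left (by linarith), zero_mul, add_zero]
        have h0 : 0 ≤ ⟪g, w⟫ := nonneg_of_mul_nonneg_right h (by positivity)
        have : m⁻¹ * ⟪g, w⟫ ≤ ⟪g, w⟫ := mul_le_of_le_one_left h0 (inv_le_one_of_one_le₀ hm)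
        linarith
      · rw [max_eq_right (by linarith)]
        have h3 := mul_le_mul_of_nonneg_left h2 (neg_nonneg.mpr h)
        have h4 : -(m⁻¹ * ⟪g, w⟫) * (m - 1) = m⁻¹ * ⟪g, w⟫ - ⟪g, w⟫ := by
          field_simp; ring
        linarith
  have hlin : 2 * a ^ 2 - 2 * a * b - 6 * θ * a ≤ ⟪G, w - x⟫ := by
    rw [inner_sub_right, inner_smul_right] at hloc
    rw [hκm] at hlin0
    nlinarith [mul_le_mul_of_nonneg_left hκw.1 hθ0]
  have hquad : ‖G‖ ≤ 11 * a := by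
    rcases hG with ⟨-, rfl⟩ | ⟨h1, -, rfl⟩
    · linarith
    · have h5 : |m⁻¹ * ⟪g, w⟫| ≤ 9 * a := by
        rw [hκm, mul_assoc, abs_mul, abs_of_nonneg (by linarith)]
        have : |κ * ⟪g, w⟫| ≤ 6 * a := abs_le.mpr hκw
        nlinarith
      have h6 : ‖max 0 (-(m⁻¹ * ⟪g, w⟫)) • S‖ ≤ 9 * a := by
        rw [norm_smul, Real.norm_of_nonneg (le_max_left _ _)]
        have : max 0 (-(m⁻¹ * ⟪g, w⟫)) ≤ 9 * a :=
          max_le (by linarith) (by linarith [(abs_le.mp h5).1])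
        calc _ ≤ (9 * a) * 1 := mul_le_mul this h1 (norm_nonneg _) (by linarith)
          _ = _ := mul_one _
      linarith [norm_add_le g (max 0 (-(m⁻¹ * ⟪g, w⟫)) • S)]
  have hsq : ‖G‖ ^ 2 ≤ 121 * a ^ 2 := by nlinarith [norm_nonneg G]
  have e : w - (1 / 121 : ℝ) • G - x = (w - x) - (1 / 121 : ℝ) • G := by abel
  rw [e, norm_sub_sq_real, inner_smul_right, norm_smul, real_inner_comm, mul_pow]
  norm_num
  linarith

/-- The regret of one round of the learner, against a comparator `X` in the feasible set. -/
theorem learner_step {𝓛 : Submodule ℝ (Mat d)} {L R m θ : ℝ} {W X B g S G : Mat d} {u s : Vec d}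
    (hL : 0 < L) (hX : X ∈ 𝓛) (hXR : frobNorm X ≤ R) (hW : W ∈ 𝓛) (hs : s ≠ 0) (hm : 1 ≤ m)
    (hθ0 : 0 ≤ θ) (hθ : θ ≤ 1 / 2) (hop : opNorm W ≤ 3 * ((1 + θ) * m))
    (hB : B = L • (((1 + θ) * m)⁻¹ • W) + L • (1 : Mat d))
    (hg : IsFrobProj 𝓛 (L⁻¹ • lossGrad u s B) g)
    (hG : (m = 1 ∧ G = g) ∨ (frobNorm S ≤ 1 ∧ m - 1 ≤ frobInner S (W - X) ∧
      G = g + max 0 (-(m⁻¹ * frobInner g W)) • S)) :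
    121 * ‖toVec (ballProj R (W - (1 / 121 : ℝ) • G)) - toVec X‖ ^ 2 ≤
      121 * ‖toVec W - toVec X‖ ^ 2 - (3 * (‖u - mv B s‖ / (L * ‖s‖)) ^ 2
        - 4 * (‖u - mv B s‖ / (L * ‖s‖)) * (‖u - mv (L • X + L • (1 : Mat d)) s‖ / (L * ‖s‖))
        - 12 * θ * (‖u - mv B s‖ / (L * ‖s‖))) := by
  have hs0 : 0 < ‖s‖ := norm_pos_iff.mpr hs
  set e := u - mv B s with he
  set e' := u - mv (L • X + L • (1 : Mat d)) s with he'
  have hR : 0 ≤ R := (Real.sqrt_nonneg _).trans hXR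
  have hgH : ∀ H ∈ 𝓛, ⟪toVec g, toVec H⟫ = L⁻¹ * (-2 * ⟪e, mv H s⟫ / ‖s‖ ^ 2) := by
    intro H hH
    rw [← frobInner_eq, hg.inner_eq hH, frobInner_eq, map_smul, inner_smul_left, ← frobInner_eq,
      frobInner_lossGrad]
    rfl
  have hgn : ‖toVec g‖ ≤ 2 * (‖e‖ / (L * ‖s‖)) := by
    have := hg.norm_le
    rw [frobNorm_eq, frobNorm_eq, map_smul, norm_smul, ← frobNorm_eq (lossGrad u s B),
      frobNorm_lossGrad hs, Real.norm_of_nonneg (by positivity)] at this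
    refine this.trans (le_of_eq ?_)
    rw [he]; field_simp
  have hgw : |⟪toVec g, toVec W⟫| ≤ 2 * (‖e‖ / (L * ‖s‖)) * (3 * ((1 + θ) * m)) := by
    rw [hgH W hW]
    have h1 : |⟪e, mv W s⟫| ≤ ‖e‖ * (3 * ((1 + θ) * m) * ‖s‖) :=
      (abs_real_inner_le_norm _ _).trans
        (by gcongr; exact (norm_mv_le W s).trans (by gcongr))
    calc |L⁻¹ * (-2 * ⟪e, mv W s⟫ / ‖s‖ ^ 2)| = L⁻¹ * (2 * |⟪e, mv W s⟫| / ‖s‖ ^ 2) := by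
          rw [abs_mul, abs_div, abs_mul, abs_of_pos (inv_pos.mpr hL), abs_of_pos (pow_pos hs0 2)]
          norm_num
      _ ≤ L⁻¹ * (2 * (‖e‖ * (3 * ((1 + θ) * m) * ‖s‖)) / ‖s‖ ^ 2) := by gcongr
      _ = _ := by field_simp
  have hloc : 2 * (‖e‖ / (L * ‖s‖)) ^ 2 - 2 * (‖e‖ / (L * ‖s‖)) * (‖e'‖ / (L * ‖s‖)) ≤
      ⟪toVec g, ((1 + θ) * m)⁻¹ • toVec W - toVec X⟫ := by
    rw [← map_smul, ← map_sub, hgH _ (𝓛.sub_mem (𝓛.smul_mem _ hW) hX)]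
    have h1 : mv (((1 + θ) * m)⁻¹ • W - X) s = L⁻¹ • (e' - e) := by
      rw [he, he', hB]
      simp only [mv_sub, mv_add, mv_smul]
      rw [sub_sub_sub_cancel_left, add_sub_add_right_eq_sub, ← smul_sub, smul_smul,
        inv_mul_cancel₀ hL.ne', one_smul]
    rw [h1, inner_smul_right, inner_sub_right, real_inner_self_eq_norm_sq]
    have h2 := real_inner_le_norm e e'
    calc 2 * (‖e‖ / (L * ‖s‖)) ^ 2 - 2 * (‖e‖ / (L * ‖s‖)) * (‖e'‖ / (L * ‖s‖))
        = 2 * (‖e‖ ^ 2 - ‖e‖ * ‖e'‖) / (L * ‖s‖) ^ 2 := by field_simp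
      _ ≤ 2 * (‖e‖ ^ 2 - ⟪e, e'⟫) / (L * ‖s‖) ^ 2 := by gcongr
      _ = _ := by field_simp; ring
  have key := surrogate_step (w := toVec W) (x := toVec X) (g := toVec g) (S := toVec S)
    (G := toVec G) hm hθ0 hθ (by positivity) hgn hgw hloc (by
      rcases hG with ⟨h1, rfl⟩ | ⟨h1, h2, rfl⟩
      · exact Or.inl ⟨h1, rfl⟩
      · refine Or.inr ⟨by rwa [← frobNorm_eq], by rwa [← map_sub, ← frobInner_eq], ?_⟩
        rw [map_add, map_smul, frobInner_eq])
  refine le_trans ?_ key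
  have hproj := norm_radial_sub_le hR (toVec (W - (1 / 121 : ℝ) • G)) (toVec X)
    (by rwa [← frobNorm_eq])
  rw [← toVec_ballProj, map_sub toVec W, map_smul] at hproj
  gcongr

/-! ### Standing assumptions and invariants of a run -/

/-- The assumptions on the operator and on the parameters of the method. -/
structure Admissible (I : Input d) (L₂ : ℝ) : Prop where
  mono : ∀ z z', 0 ≤ ⟪I.F z - I.F z', z - z'⟫
  L₁_pos : 0 < I.L₁
  lip : ∀ z z', ‖I.F z - I.F z'‖ ≤ I.L₁ * ‖z - z'‖
  diff : Differentiable ℝ I.F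
  L₂_nonneg : 0 ≤ L₂
  lip_fderiv : ∀ z z', ‖fderiv ℝ I.F z - fderiv ℝ I.F z'‖ ≤ L₂ * ‖z - z'‖
  one_mem : (1 : Mat d) ∈ I.𝓛
  jac_mem : ∀ z, jac I.F z ∈ I.𝓛
  α₁_pos : 0 < I.α₁
  α₁_lt : I.α₁ < 1 / 2
  α₂_pos : 0 < I.α₂
  α₂_lt : I.α₂ < 1 / 2
  β_pos : 0 < I.β
  β_lt : I.β < 1
  σ₀_ge : I.α₂ * I.β / (5 * I.L₁) ≤ I.σ₀
  B₀_mem : I.B₀ ∈ setZ I.L₁ I.𝓛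
  ρ_eq : I.ρ = 1 / 121
  δ_eq : I.δ = delta
  R_ge : ∀ A ∈ setC I.𝓛, frobNorm A ≤ I.R
  R_le : I.R ≤ 3 * Real.sqrt d

/-- Every oracle call that is made in the run succeeds. -/
def Run.Successful {I : Input d} (r : Run I) : Prop :=
  ∀ t, 1 ≤ t → r.Reaches t →
    ExtEvecSuccess (r.W t) (I.δ t) (r.ext t) ∧ MaxSvecSuccess (r.W t) (I.δ t) (r.svd t)

theorem delta_pos (t : ℕ) : 0 < delta t := by unfold delta; positivity

theorem delta_le (t : ℕ) : delta t ≤ 1 / 2 := by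
  unfold delta
  have : (1 : ℝ) ≤ ((t : ℝ) + 1) ^ (1 / 4 : ℝ) :=
    Real.one_le_rpow (by linarith [Nat.cast_nonneg (α := ℝ) t]) (by norm_num)
  rw [div_le_div_iff₀ (by positivity) (by norm_num)]
  linarith

theorem delta_sq_le (t : ℕ) : delta t ^ 2 ≤ (Real.sqrt ((t : ℝ) + 1) - Real.sqrt t) / 2 := by
  have h0 : (0 : ℝ) ≤ t := Nat.cast_nonneg t
  have h1 : (((t : ℝ) + 1) ^ (1 / 4 : ℝ)) ^ 2 = Real.sqrt ((t : ℝ) + 1) := by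
    rw [Real.sqrt_eq_rpow, ← Real.rpow_natCast, ← Real.rpow_mul (by linarith)]; norm_num
  have h2 : delta t ^ 2 = 1 / (4 * Real.sqrt ((t : ℝ) + 1)) := by
    rw [← h1]; unfold delta; ring
  have h3 : Real.sqrt t ≤ Real.sqrt ((t : ℝ) + 1) := Real.sqrt_le_sqrt (by linarith)
  have h4 : 0 < Real.sqrt ((t : ℝ) + 1) := Real.sqrt_pos.mpr (by linarith)
  have h5 := Real.sq_sqrt h0
  have h6 := Real.sq_sqrt (show (0 : ℝ) ≤ (t : ℝ) + 1 by linarith)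
  rw [h2, div_le_div_iff₀ (by positivity) (by norm_num)]
  nlinarith [sq_nonneg (Real.sqrt ((t : ℝ) + 1) - Real.sqrt t)]

theorem Admissible.R_nonneg {I : Input d} {L₂ : ℝ} (h : Admissible I L₂) : 0 ≤ I.R := by
  refine (Real.sqrt_nonneg _).trans (h.R_ge 0 ?_)
  rw [mem_setC_iff]
  refine ⟨fun v => ?_, ?_, I.𝓛.zero_mem⟩
  · simp [mv]
  · simp [opNorm]

/-- The comparator: the Jacobian at `z` in the coordinates of the learner. -/
noncomputable def comparator (I : Input d) (z : Vec d) : Mat d := centered I.L₁ (jac I.F z)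

theorem Admissible.comparator_mem {I : Input d} {L₂ : ℝ} (h : Admissible I L₂) (z : Vec d) :
    comparator I z ∈ setC I.𝓛 :=
  centered_mem_setC h.L₁_pos h.one_mem (h.jac_mem z)
    (fun v => by rw [mv_jac]; exact inner_fderiv_nonneg h.diff h.mono z v)
    (opNorm_jac_le h.L₁_pos h.lip z)

theorem mem_setC_subset {𝓛 : Submodule ℝ (Mat d)} {A : Mat d} (h : A ∈ setC 𝓛) : A ∈ 𝓛 :=
  h.2.2.2

/-- Relative accuracy of the oracles in round `t`; it is `0` in round `0`, which calls no
oracle. -/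
def Input.acc (I : Input d) (t : ℕ) : ℝ := if t = 0 then 0 else I.δ t

theorem Admissible.acc_nonneg {I : Input d} {L₂ : ℝ} (h : Admissible I L₂) (t : ℕ) :
    0 ≤ I.acc t := by
  unfold Input.acc; split_ifs
  · exact le_rfl
  · rw [h.δ_eq]; exact (delta_pos t).le

theorem Admissible.acc_le {I : Input d} {L₂ : ℝ} (h : Admissible I L₂) (t : ℕ) :
    I.acc t ≤ 1 / 2 := by
  unfold Input.acc; split_ifs
  · norm_num
  · rw [h.δ_eq]; exact delta_le t

theorem Admissible.acc_sq_le {I : Input d} {L₂ : ℝ} (h : Admissible I L₂) (t : ℕ) :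
    I.acc t ^ 2 ≤ (Real.sqrt ((t + 1 : ℕ) : ℝ) - Real.sqrt t) / 2 := by
  have := delta_sq_le t
  push_cast
  unfold Input.acc; split_ifs
  · exact le_trans (by simpa using sq_nonneg (delta t)) this
  · rw [h.δ_eq]; exact this

namespace Run

variable {I : Input d} {L₂ : ℝ} (r : Run I)

/-- The factor `max {1, γ_t}` by which the auxiliary iterate is scaled down; it is `1` in
round `0`. -/
noncomputable def scale (t : ℕ) : ℝ := if t = 0 then 1 else max 1 (r.γ t)

theorem one_le_scale (t : ℕ) : 1 ≤ r.scale t := by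
  unfold scale; split_ifs
  · exact le_rfl
  · exact le_max_left _ _

theorem W_zero_eq : r.W 0 = centered I.L₁ I.B₀ := r.W_zero

theorem W_zero_mem (h : Admissible I L₂) : r.W 0 ∈ setC I.𝓛 := by
  obtain ⟨h1, -, h3, h4⟩ := h.B₀_mem
  rw [W_zero_eq]
  exact centered_mem_setC h.L₁_pos h.one_mem h4 (zero_le_symPart_iff.mp h1) h3

theorem B_eq (h : Admissible I L₂) (t : ℕ) :
    r.B t = I.L₁ • (((1 + I.acc t) * r.scale t)⁻¹ • r.W t) + I.L₁ • (1 : Mat d) := by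
  rcases Nat.eq_zero_or_pos t with rfl | ht
  · simp only [Input.acc, scale, if_true, add_zero, mul_one, inv_one, one_smul]
    rw [W_zero_eq, smul_centered_add h.L₁_pos.ne', r.B_zero]
  · rw [r.B_succ t ht, Input.acc, scale, if_neg ht.ne', if_neg ht.ne']
    split_ifs with hγ
    · rw [max_eq_left hγ, mul_one]
    · rw [max_eq_right (not_le.mp hγ).le]

theorem S_mem {t : ℕ} (ht : 1 ≤ t) : r.S t ∈ I.𝓛 := by
  rcases r.query t ht with ⟨-, -, h⟩ | ⟨-, -, h⟩ <;> exact h.1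

theorem W_mem (h : Admissible I L₂) (k : ℕ) :
    r.W (r.round k) ∈ I.𝓛 ∧ frobNorm (r.W (r.round k)) ≤ I.R := by
  induction k with
  | zero =>
    rw [r.round_zero]
    exact ⟨mem_setC_subset (r.W_zero_mem h), h.R_ge _ (r.W_zero_mem h)⟩
  | succ k ih =>
    rw [r.round_succ]
    split_ifs with hk
    · exact ih
    · rw [r.W_succ k hk]
      refine ⟨?_, frobNorm_ballProj_le h.R_nonneg _⟩
      refine I.𝓛.smul_mem _ (I.𝓛.sub_mem ih.1 (I.𝓛.smul_mem _ ?_))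
      split_ifs with h0
      · exact (r.grad k hk).1
      · exact I.𝓛.add_mem (r.grad k hk).1
          (I.𝓛.smul_mem _ (r.S_mem (Nat.one_le_iff_ne_zero.mpr fun h1 => h0 (Or.inl h1))))

theorem W_quadratic_le (h : Admissible I L₂) (hs : r.Successful) {t : ℕ} (ht : r.Reaches t)
    (v : Vec d) : |⟪mv (r.W t) v, v⟫| ≤ (1 + I.acc t) * r.scale t * ‖v‖ ^ 2 := by
  rcases Nat.eq_zero_or_pos t with rfl | ht0
  · simpa [Input.acc, scale] using (mem_setC_iff.mp (r.W_zero_mem h)).1 v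
  · obtain ⟨h0, -, h1, h2⟩ := (hs t ht0 ht).1
    have hacc : I.acc t = I.δ t := if_neg ht0.ne'
    have hsc : r.scale t = max 1 (r.γ t) := if_neg ht0.ne'
    have hδ : 0 ≤ I.δ t := hacc ▸ h.acc_nonneg t
    have hγ : (r.ext t).1 ≤ r.γ t := by
      rcases r.query t ht0 with ⟨-, e, -⟩ | ⟨hle, e, -⟩
      · exact e.ge
      · rw [e]; exact hle
    have key : |⟪mv (r.W t) v, v⟫| ≤ (1 + I.δ t) * max 1 (r.ext t).1 * ‖v‖ ^ 2 := by
      rcases le_or_gt (r.ext t).1 1 with hle | hlt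
      · obtain ⟨a, b⟩ := h1 hle
        rw [← neg_smul, smul_one_le_symPart_iff] at a
        rw [symPart_le_smul_one_iff] at b
        rw [max_eq_left hle, mul_one, abs_le]
        exact ⟨by linarith [a v], b v⟩
      · obtain ⟨a, b, -⟩ := h2 hlt
        have e : (r.ext t).1⁻¹ • symPart (r.W t) = symPart ((r.ext t).1⁻¹ • r.W t) := by
          simp only [symPart, Matrix.transpose_smul, ← smul_add]
          rw [smul_comm]
        rw [e, ← neg_smul, smul_one_le_symPart_iff] at a
        rw [e, symPart_le_smul_one_iff] at b
        have a := a v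
        have b := b v
        rw [mv_smul, inner_smul_left, conj_trivial] at a b
        rw [inv_mul_le_iff₀ h0] at b
        rw [← div_eq_inv_mul, le_div_iff₀ h0] at a
        rw [max_eq_right hlt.le, abs_le]
        constructor <;> linarith
    rw [hacc, hsc]
    exact key.trans (by gcongr)

theorem opNorm_W_le (h : Admissible I L₂) (hs : r.Successful) {t : ℕ} (ht : r.Reaches t) :
    opNorm (r.W t) ≤ 3 * ((1 + I.acc t) * r.scale t) := by
  rcases Nat.eq_zero_or_pos t with rfl | ht0
  · simpa [Input.acc, scale] using (mem_setC_iff.mp (r.W_zero_mem h)).2.1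
  · obtain ⟨h0, h1, h2⟩ := (hs t ht0 ht).2
    have hacc : I.acc t = I.δ t := if_neg ht0.ne'
    have hsc : r.scale t = max 1 (r.γ t) := if_neg ht0.ne'
    have hδ : 0 ≤ I.δ t := hacc ▸ h.acc_nonneg t
    have hγ : (r.svd t).1 ≤ r.γ t := by
      rcases r.query t ht0 with ⟨hle, e, -⟩ | ⟨-, e, -⟩
      · rw [e]; exact hle
      · exact e.ge
    have key : opNorm (r.W t) ≤ 3 * ((1 + I.δ t) * max 1 (r.svd t).1) := by
      rcases le_or_gt (r.svd t).1 1 with hle | hlt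
      · rw [max_eq_left hle, mul_one]; exact h1 hle
      · obtain ⟨a, -⟩ := h2 hlt
        rw [opNorm_smul, abs_of_pos (inv_pos.mpr h0), inv_mul_le_iff₀ h0] at a
        rw [max_eq_right hlt.le]; linarith
    rw [hacc, hsc]
    exact key.trans (by gcongr)

theorem S_spec (hs : r.Successful) {t : ℕ} (ht0 : 1 ≤ t) (ht : r.Reaches t)
    (hW : r.W t ∈ I.𝓛) (hγ : 1 < r.γ t) :
    frobNorm (r.S t) ≤ 1 ∧ ∀ X ∈ setC I.𝓛, r.γ t - 1 ≤ frobInner (r.S t) (r.W t - X) := by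
  obtain ⟨⟨-, -, -, h2⟩, -, -, h3⟩ := hs t ht0 ht
  rcases r.query t ht0 with ⟨-, e, hp⟩ | ⟨-, e, hp⟩
  · rw [e] at hγ ⊢
    obtain ⟨-, -, h4, h5⟩ := h2 hγ
    refine ⟨hp.norm_le.trans h4, fun X hX => ?_⟩
    rw [hp.inner_eq (I.𝓛.sub_mem hW (mem_setC_subset hX))]
    exact h5 X hX.1 hX.2.1
  · rw [e] at hγ ⊢
    obtain ⟨-, h4, h5⟩ := h3 hγ
    refine ⟨hp.norm_le.trans h4, fun X hX => ?_⟩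
    rw [hp.inner_eq (I.𝓛.sub_mem hW (mem_setC_subset hX))]
    exact h5 X hX.2.2.1

theorem inner_B_nonneg (h : Admissible I L₂) (hs : r.Successful) (k : ℕ) (v : Vec d) :
    0 ≤ ⟪mv (r.B (r.round k)) v, v⟫ := by
  have h1 := r.W_quadratic_le h hs ⟨k, rfl⟩ v
  have hc : 0 < (1 + I.acc (r.round k)) * r.scale (r.round k) :=
    mul_pos (by linarith [h.acc_nonneg (r.round k)]) (by linarith [r.one_le_scale (r.round k)])
  have h2 : -‖v‖ ^ 2 ≤ ((1 + I.acc (r.round k)) * r.scale (r.round k))⁻¹ *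
      ⟪mv (r.W (r.round k)) v, v⟫ := by
    rw [← div_eq_inv_mul, le_div_iff₀ hc]
    linarith [(abs_le.mp h1).1]
  rw [r.B_eq h]
  simp only [mv_add, mv_smul, mv_one, inner_add_left, inner_smul_left, conj_trivial,
    real_inner_self_eq_norm_sq]
  nlinarith [h.L₁_pos]

theorem opNorm_B_le (h : Admissible I L₂) (hs : r.Successful) (k : ℕ) :
    opNorm (r.B (r.round k)) ≤ 4 * I.L₁ := by
  have h1 := r.opNorm_W_le h hs ⟨k, rfl⟩
  have hc : 0 < (1 + I.acc (r.round k)) * r.scale (r.round k) :=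
    mul_pos (by linarith [h.acc_nonneg (r.round k)]) (by linarith [r.one_le_scale (r.round k)])
  rw [r.B_eq h]
  refine (opNorm_add_le _ _).trans ?_
  rw [opNorm_smul, opNorm_smul, opNorm_smul, abs_of_pos h.L₁_pos, abs_of_pos (inv_pos.mpr hc)]
  have h2 : ((1 + I.acc (r.round k)) * r.scale (r.round k))⁻¹ * opNorm (r.W (r.round k)) ≤ 3 := by
    rw [inv_mul_le_iff₀ hc]; linarith
  nlinarith [h.L₁_pos, opNorm_one_le (d := d)]

/-- Regret of the learner at a backtracking iteration, against the Jacobian at `z_k`. -/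
theorem learner_regret (h : Admissible I L₂) (hs : r.Successful) (k : ℕ) (hk : r.rej k ≠ 0)
    {u s : Vec d} (hu : u = I.F (r.trial k (r.rej k - 1)) - I.F (r.z k))
    (hs' : s = r.trial k (r.rej k - 1) - r.z k) (hs0 : s ≠ 0) :
    121 * ‖toVec (r.W (r.round k + 1)) - toVec (comparator I (r.z k))‖ ^ 2 ≤
      121 * ‖toVec (r.W (r.round k)) - toVec (comparator I (r.z k))‖ ^ 2
        - (3 * (‖u - mv (r.B (r.round k)) s‖ / (I.L₁ * ‖s‖)) ^ 2
        - 4 * (‖u - mv (r.B (r.round k)) s‖ / (I.L₁ * ‖s‖)) *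
          (‖u - mv (jac I.F (r.z k)) s‖ / (I.L₁ * ‖s‖))
        - 12 * I.acc (r.round k) * (‖u - mv (r.B (r.round k)) s‖ / (I.L₁ * ‖s‖))) := by
  have hX := h.comparator_mem (r.z k)
  have hW := (r.W_mem h k).1
  have hg := r.grad k hk
  rw [← hu, ← hs'] at hg
  have e : jac I.F (r.z k) = I.L₁ • comparator I (r.z k) + I.L₁ • (1 : Mat d) :=
    (smul_centered_add h.L₁_pos.ne' _).symm
  rw [r.W_succ k hk, h.ρ_eq, e]
  refine learner_step (S := r.S (r.round k)) h.L₁_pos (mem_setC_subset hX) (h.R_ge _ hX) hW hs0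
    (r.one_le_scale _) (h.acc_nonneg _) (h.acc_le _) (r.opNorm_W_le h hs ⟨k, rfl⟩) (r.B_eq h _)
    hg ?_
  by_cases h0 : r.round k = 0 ∨ r.γ (r.round k) ≤ 1
  · left
    rw [if_pos h0]
    refine ⟨?_, rfl⟩
    unfold scale
    rcases h0 with h0 | h0
    · rw [if_pos h0]
    · rw [max_eq_left h0, ite_self]
  · right
    rw [if_neg h0]
    push Not at h0
    obtain ⟨h1, h2⟩ := r.S_spec hs (Nat.one_le_iff_ne_zero.mpr h0.1) ⟨k, rfl⟩ hW h0.2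
    have hsc : r.scale (r.round k) = r.γ (r.round k) := by
      rw [scale, if_neg h0.1, max_eq_right h0.2.le]
    rw [hsc]
    exact ⟨h1, h2 _ hX, rfl⟩

end Run

/-! ### Extragradient steps and the line search -/

/-- Two inexact solutions of `(1 + τ B) s = -τ f` for a monotone `B`, with step sizes `τ` and `β τ`,
have comparable norms. With `n = ‖s' - s‖`, pairing the difference of the two equations with
`s' - s` gives `n * (β * ‖s'‖ - ‖s‖) ≤ n * α * (β * ‖s'‖ + ‖s‖)`. -/
theorem norm_solution_le {B : Mat d} (hB : ∀ v, 0 ≤ ⟪mv B v, v⟫) {α β τ : ℝ} (hα : 0 ≤ α)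
    (hβ : 0 < β) (hβ1 : β < 1) (hτ : 0 < τ) {f s s' : Vec d}
    (h' : ‖s' + τ • mv B s' + τ • f‖ ≤ α * ‖s'‖)
    (h : ‖s + (β * τ) • mv B s + (β * τ) • f‖ ≤ α * ‖s‖) :
    β * (1 - α) * ‖s'‖ ≤ (1 + α) * ‖s‖ := by
  rcases le_or_gt ‖s'‖ ‖s‖ with hle | hlt
  · have h1 : β * ‖s'‖ ≤ 1 * ‖s‖ := mul_le_mul hβ1.le hle (norm_nonneg _) zero_le_one
    nlinarith [mul_nonneg hα (mul_nonneg hβ.le (norm_nonneg s')), mul_nonneg hα (norm_nonneg s)]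
  · set n := ‖s' - s‖ with hn
    have hn1 : ‖s'‖ - ‖s‖ ≤ n := norm_sub_norm_le _ _
    have hn0 : 0 < n := by linarith
    have e : β • (s' + τ • mv B s' + τ • f) - (s + (β * τ) • mv B s + (β * τ) • f)
        = (β • s' - s) + (β * τ) • mv B (s' - s) := by
      rw [mv_vec_sub]; module
    have h1 : ⟪(β • s' - s) + (β * τ) • mv B (s' - s), s' - s⟫ ≤
        (β * (α * ‖s'‖) + α * ‖s‖) * n := by
      rw [← e]
      refine (real_inner_le_norm _ _).trans ?_
      gcongr
      refine (norm_sub_le _ _).trans ?_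
      rw [norm_smul, Real.norm_of_nonneg hβ.le]
      gcongr
    rw [inner_add_left, inner_smul_left, conj_trivial] at h1
    have h2 := mul_nonneg (mul_pos hβ hτ).le (hB (s' - s))
    have h3 : ⟪β • s' - s, s' - s⟫ =
        -(1 - β) / 2 * (‖s'‖ ^ 2 - ‖s‖ ^ 2) + (1 + β) / 2 * n ^ 2 := by
      rw [hn, norm_sub_sq_real, inner_sub_left, inner_sub_right, inner_sub_right, inner_smul_left,
        inner_smul_left, conj_trivial, real_inner_self_eq_norm_sq, real_inner_self_eq_norm_sq,
        real_inner_comm s' s]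
      ring
    have h4 : n * (β * ‖s'‖ - ‖s‖) ≤ ⟪β • s' - s, s' - s⟫ := by
      rw [h3]
      have h5 : (1 - β) / 2 * ((‖s'‖ - ‖s‖) * (‖s'‖ + ‖s‖)) ≤
          (1 - β) / 2 * (n * (‖s'‖ + ‖s‖)) := by
        gcongr
      have h6 : (1 + β) / 2 * (n * (‖s'‖ - ‖s‖)) ≤ (1 + β) / 2 * (n * n) := by gcongr
      nlinarith
    have h7 : n * (β * ‖s'‖ - ‖s‖) ≤ n * (α * (β * ‖s'‖ + ‖s‖)) := by nlinarith
    have h8 := le_of_mul_le_mul_left h7 hn0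
    linarith

namespace Run

variable {I : Input d} {L₂ : ℝ} (r : Run I)

theorem σ_pos (h : Admissible I L₂) (k : ℕ) : 0 < r.σ k := by
  induction k with
  | zero =>
    rw [r.σ_zero]
    refine lt_of_lt_of_le ?_ h.σ₀_ge
    have := h.α₂_pos; have := h.β_pos; have := h.L₁_pos
    positivity
  | succ k ih =>
    rw [r.σ_succ]
    have := h.β_pos
    positivity

theorem η_pos (h : Admissible I L₂) (k : ℕ) : 0 < r.η k :=
  mul_pos (r.σ_pos h k) (pow_pos h.β_pos _)

/-- The decrease of the distance to an arbitrary reference point in one extragradient step. -/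
theorem extragradient_step (h : Admissible I L₂) (k : ℕ) (z' : Vec d) :
    2 * (r.η k * ⟪I.F (r.zhat k), r.zhat k - z'⟫) + ‖r.z (k + 1) - z'‖ ^ 2 +
      (1 - (I.α₁ + I.α₂) ^ 2) * ‖r.zhat k - r.z k‖ ^ 2 ≤ ‖r.z k - z'‖ ^ 2 := by
  have hα : 0 ≤ I.α₁ + I.α₂ := by linarith [h.α₁_pos, h.α₂_pos]
  have hacc : ‖r.zhat k - r.z k + r.η k • I.F (r.zhat k)‖ ≤
      (I.α₁ + I.α₂) * ‖r.zhat k - r.z k‖ := r.accepted k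
  have hz : r.z (k + 1) = r.z k - r.η k • I.F (r.zhat k) := r.z_succ k
  have hsq := pow_le_pow_left₀ (norm_nonneg _) hacc 2
  rw [mul_pow] at hsq
  set s := r.zhat k - r.z k with hs
  set g := r.η k • I.F (r.zhat k) with hg
  have e1 : r.η k * ⟪I.F (r.zhat k), r.zhat k - z'⟫ = ⟪g, s⟫ + ⟪g, r.z k - z'⟫ := by
    rw [← inner_add_right, hg, inner_smul_left, conj_trivial, hs, sub_add_sub_cancel]
  have e2 : r.z (k + 1) - z' = (r.z k - z') - g := by rw [hz]; abel
  rw [e1, e2, norm_sub_sq_real, real_inner_comm g (r.z k - z')]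
  rw [norm_add_sq_real, real_inner_comm g s] at hsq
  linarith

theorem norm_z_succ_sub_le (k : ℕ) :
    ‖r.z (k + 1) - r.z k‖ ≤ (1 + (I.α₁ + I.α₂)) * ‖r.zhat k - r.z k‖ := by
  have hacc : ‖r.zhat k - r.z k + r.η k • I.F (r.zhat k)‖ ≤
      (I.α₁ + I.α₂) * ‖r.zhat k - r.z k‖ := r.accepted k
  have hz : r.z (k + 1) = r.z k - r.η k • I.F (r.zhat k) := r.z_succ k
  have e : r.z (k + 1) - r.z k =
      (r.zhat k - r.z k) - (r.zhat k - r.z k + r.η k • I.F (r.zhat k)) := by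
    rw [hz]; abel
  rw [e]
  linarith [norm_sub_le (r.zhat k - r.z k) (r.zhat k - r.z k + r.η k • I.F (r.zhat k))]

theorem one_sub_sq_pos (h : Admissible I L₂) : 0 < 1 - (I.α₁ + I.α₂) ^ 2 := by
  nlinarith [h.α₁_pos, h.α₂_pos, h.α₁_lt, h.α₂_lt]

theorem norm_step_add_le (h : Admissible I L₂) {zs : Vec d} (hzs : I.F zs = 0) (k : ℕ) :
    ‖r.z (k + 1) - zs‖ ^ 2 + (1 - (I.α₁ + I.α₂) ^ 2) * ‖r.zhat k - r.z k‖ ^ 2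
      ≤ ‖r.z k - zs‖ ^ 2 := by
  have h1 := r.extragradient_step h k zs
  have h2 := h.mono (r.zhat k) zs
  rw [hzs, sub_zero] at h2
  have := mul_nonneg (r.η_pos h k).le h2
  linarith

theorem norm_z_succ_sub_zero_le (h : Admissible I L₂) {zs : Vec d} (hzs : I.F zs = 0) (k : ℕ) :
    ‖r.z (k + 1) - zs‖ ≤ ‖r.z k - zs‖ := by
  apply le_of_sq_le_sq _ (norm_nonneg _)
  have := mul_nonneg (one_sub_sq_pos h).le (sq_nonneg ‖r.zhat k - r.z k‖)
  linarith [r.norm_step_add_le h hzs k]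

theorem sum_norm_sq_le (h : Admissible I L₂) {zs : Vec d} (hzs : I.F zs = 0) (N : ℕ) :
    (1 - (I.α₁ + I.α₂) ^ 2) * ∑ i ∈ Finset.range N, ‖r.zhat i - r.z i‖ ^ 2 ≤
      ‖I.z₀ - zs‖ ^ 2 := by
  have key : ∀ N, ‖r.z N - zs‖ ^ 2 +
      (1 - (I.α₁ + I.α₂) ^ 2) * ∑ i ∈ Finset.range N, ‖r.zhat i - r.z i‖ ^ 2 ≤
      ‖I.z₀ - zs‖ ^ 2 := by
    intro N
    induction N with
    | zero => simp [r.z_zero]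
    | succ n ih =>
      rw [Finset.sum_range_succ, mul_add]
      linarith [r.norm_step_add_le h hzs n]
  linarith [key N, sq_nonneg ‖r.z N - zs‖]

theorem sum_linearized_gap_le (h : Admissible I L₂) (N : ℕ) (z' : Vec d) :
    ∑ i ∈ Finset.range N, r.η i * ⟪I.F (r.zhat i), r.zhat i - z'⟫ ≤ ‖I.z₀ - z'‖ ^ 2 / 2 := by
  have key : ∀ N, 2 * ∑ i ∈ Finset.range N, r.η i * ⟪I.F (r.zhat i), r.zhat i - z'⟫ +
      ‖r.z N - z'‖ ^ 2 ≤ ‖I.z₀ - z'‖ ^ 2 := by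
    intro N
    induction N with
    | zero => simp [r.z_zero]
    | succ n ih =>
      rw [Finset.sum_range_succ, mul_add]
      have := mul_nonneg (one_sub_sq_pos h).le (sq_nonneg ‖r.zhat n - r.z n‖)
      linarith [r.extragradient_step h n z']
  linarith [key N, sq_nonneg ‖r.z N - z'‖]

theorem sum_norm_z_succ_sub_le (h : Admissible I L₂) {zs : Vec d} (hzs : I.F zs = 0) (N : ℕ) :
    ∑ i ∈ Finset.range N, ‖r.z (i + 1) - r.z i‖ ≤
      Real.sqrt N * (Real.sqrt 2 * ‖I.z₀ - zs‖ / Real.sqrt (1 - I.α₁ - I.α₂)) := by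
  have hα0 : 0 ≤ I.α₁ + I.α₂ := by linarith [h.α₁_pos, h.α₂_pos]
  have hα1 : 0 < 1 - I.α₁ - I.α₂ := by linarith [h.α₁_lt, h.α₂_lt]
  apply le_of_sq_le_sq _ (by positivity)
  have h1 : (∑ i ∈ Finset.range N, ‖r.z (i + 1) - r.z i‖) ^ 2 ≤
      N * ∑ i ∈ Finset.range N, ‖r.z (i + 1) - r.z i‖ ^ 2 := by
    simpa using sq_sum_le_card_mul_sum_sq (s := Finset.range N)
      (f := fun i => ‖r.z (i + 1) - r.z i‖)
  have h2 : ∑ i ∈ Finset.range N, ‖r.z (i + 1) - r.z i‖ ^ 2 ≤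
      (1 + (I.α₁ + I.α₂)) ^ 2 * ∑ i ∈ Finset.range N, ‖r.zhat i - r.z i‖ ^ 2 := by
    rw [Finset.mul_sum]
    refine Finset.sum_le_sum fun i _ => ?_
    rw [← mul_pow]
    exact pow_le_pow_left₀ (norm_nonneg _) (r.norm_z_succ_sub_le i) 2
  have h3 := r.sum_norm_sq_le h hzs N
  set T := ∑ i ∈ Finset.range N, ‖r.zhat i - r.z i‖ ^ 2
  have hT : 0 ≤ T := Finset.sum_nonneg fun i _ => sq_nonneg _
  have h4 : (1 + (I.α₁ + I.α₂)) ^ 2 * T ≤ 2 * ‖I.z₀ - zs‖ ^ 2 / (1 - I.α₁ - I.α₂) := by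
    rw [le_div_iff₀ hα1]
    have h5 : (1 + (I.α₁ + I.α₂)) ^ 2 * T * (1 - I.α₁ - I.α₂) =
        (1 + (I.α₁ + I.α₂)) * ((1 - (I.α₁ + I.α₂) ^ 2) * T) := by ring
    rw [h5]
    exact mul_le_mul (by linarith) h3 (mul_nonneg (one_sub_sq_pos h).le hT) (by norm_num)
  calc _ ≤ N * (2 * ‖I.z₀ - zs‖ ^ 2 / (1 - I.α₁ - I.α₂)) :=
        h1.trans (mul_le_mul_of_nonneg_left (h2.trans h4) (Nat.cast_nonneg N))
    _ = _ := by
        rw [mul_pow, div_pow, mul_pow, Real.sq_sqrt (Nat.cast_nonneg N),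
          Real.sq_sqrt (by norm_num), Real.sq_sqrt hα1.le]

/-- Displacement of the last rejected trial point. Here and below, the value at an iteration that
rejects nothing has no meaning and is not used. -/
def rejStep (k : ℕ) : Vec d := r.trial k (r.rej k - 1) - r.z k

/-- Change of the operator at the last rejected trial point. -/
def rejDiff (k : ℕ) : Vec d := I.F (r.trial k (r.rej k - 1)) - I.F (r.z k)

theorem rejStep_ne_zero {k : ℕ} (hk : r.rej k ≠ 0) : r.rejStep k ≠ 0 :=
  sub_ne_zero.mpr (r.rejected k (r.rej k - 1) (by omega)).1

/-- Step size of the last rejected trial point. -/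
def rejSize (k : ℕ) : ℝ := r.σ k * I.β ^ (r.rej k - 1)

theorem η_eq_mul_rejSize {k : ℕ} (hk : r.rej k ≠ 0) : r.η k = I.β * r.rejSize k := by
  obtain ⟨n, hn⟩ := Nat.exists_eq_succ_of_ne_zero hk
  rw [η, rejSize, hn, Nat.succ_sub_one, pow_succ]; ring

theorem rejSize_pos (h : Admissible I L₂) (k : ℕ) : 0 < r.rejSize k :=
  mul_pos (r.σ_pos h k) (pow_pos h.β_pos _)

theorem solver' (k i : ℕ) (hi : i ≤ r.rej k) :
    ‖(r.trial k i - r.z k) + (r.σ k * I.β ^ i) • mv (r.B (r.round k)) (r.trial k i - r.z k) +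
      (r.σ k * I.β ^ i) • I.F (r.z k)‖ ≤ I.α₁ * ‖r.trial k i - r.z k‖ := by
  have h := r.solver k i hi
  rwa [LinearSolverOutput, mv_add, mv_one, mv_smul, sub_neg_eq_add] at h

theorem norm_rejStep_le (h : Admissible I L₂) (hs : r.Successful) {k : ℕ} (hk : r.rej k ≠ 0) :
    I.β * (1 - I.α₁) * ‖r.rejStep k‖ ≤ (1 + I.α₁) * ‖r.zhat k - r.z k‖ := by
  have h1 := r.solver' k (r.rej k - 1) (by omega)
  have h2 := r.solver' k (r.rej k) le_rfl
  have e : r.σ k * I.β ^ r.rej k = I.β * (r.σ k * I.β ^ (r.rej k - 1)) := r.η_eq_mul_rejSize hk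
  rw [e] at h2
  exact norm_solution_le (r.inner_B_nonneg h hs k) h.α₁_pos.le h.β_pos h.β_lt
    (r.rejSize_pos h k) h1 h2

/-- Normalized residual of the played matrix at the last rejected trial point, and `0` if no trial
point is rejected: the square root of the loss, divided by `L₁`. -/
noncomputable def playedRes (k : ℕ) : ℝ :=
  if r.rej k = 0 then 0
  else ‖r.rejDiff k - mv (r.B (r.round k)) (r.rejStep k)‖ / (I.L₁ * ‖r.rejStep k‖)

/-- The same residual for the Jacobian at `z_k`. -/
noncomputable def jacRes (k : ℕ) : ℝ :=
  if r.rej k = 0 then 0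
  else ‖r.rejDiff k - mv (jac I.F (r.z k)) (r.rejStep k)‖ / (I.L₁ * ‖r.rejStep k‖)

theorem playedRes_le (h : Admissible I L₂) (hs : r.Successful) (k : ℕ) : r.playedRes k ≤ 5 := by
  unfold playedRes; split_ifs with hk
  · norm_num
  · have hs0 : 0 < ‖r.rejStep k‖ := norm_pos_iff.mpr (r.rejStep_ne_zero hk)
    rw [div_le_iff₀ (mul_pos h.L₁_pos hs0)]
    have h1 : ‖r.rejDiff k‖ ≤ I.L₁ * ‖r.rejStep k‖ := h.lip _ _
    have h2 : ‖mv (r.B (r.round k)) (r.rejStep k)‖ ≤ 4 * I.L₁ * ‖r.rejStep k‖ :=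
      (norm_mv_le _ _).trans (by gcongr; exact r.opNorm_B_le h hs k)
    linarith [norm_sub_le (r.rejDiff k) (mv (r.B (r.round k)) (r.rejStep k))]

/-- A rejected trial point certifies that the step size is not much smaller than the inverse of
the residual of the played matrix. -/
theorem inv_η_le_playedRes (h : Admissible I L₂) {k : ℕ} (hk : r.rej k ≠ 0) :
    (r.η k)⁻¹ ≤ I.L₁ / (I.α₂ * I.β) * r.playedRes k := by
  have hs0 : 0 < ‖r.rejStep k‖ := norm_pos_iff.mpr (r.rejStep_ne_zero hk)
  have hτ := r.rejSize_pos h k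
  have hsol : ‖r.rejStep k + r.rejSize k • mv (r.B (r.round k)) (r.rejStep k) +
      r.rejSize k • I.F (r.z k)‖ ≤ I.α₁ * ‖r.rejStep k‖ := r.solver' k (r.rej k - 1) (by omega)
  have hrej : (I.α₁ + I.α₂) * ‖r.rejStep k‖ ≤
      ‖r.rejStep k + r.rejSize k • I.F (r.trial k (r.rej k - 1))‖ :=
    (r.rejected k (r.rej k - 1) (by omega)).2
  have e : r.rejStep k + r.rejSize k • I.F (r.trial k (r.rej k - 1)) =
      (r.rejStep k + r.rejSize k • mv (r.B (r.round k)) (r.rejStep k) +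
        r.rejSize k • I.F (r.z k)) +
      r.rejSize k • (r.rejDiff k - mv (r.B (r.round k)) (r.rejStep k)) := by
    rw [rejDiff]; module
  rw [e] at hrej
  have h1 := hrej.trans (norm_add_le _ _)
  rw [norm_smul, Real.norm_of_nonneg hτ.le] at h1
  have h2 : I.α₂ * ‖r.rejStep k‖ ≤
      r.rejSize k * ‖r.rejDiff k - mv (r.B (r.round k)) (r.rejStep k)‖ := by linarith
  have := h.α₂_pos; have := h.β_pos; have := h.L₁_pos
  rw [playedRes, if_neg hk, r.η_eq_mul_rejSize hk]
  rw [show I.L₁ / (I.α₂ * I.β) * (‖r.rejDiff k - mv (r.B (r.round k)) (r.rejStep k)‖ /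
      (I.L₁ * ‖r.rejStep k‖)) = ‖r.rejDiff k - mv (r.B (r.round k)) (r.rejStep k)‖ /
      (I.α₂ * ‖r.rejStep k‖ * I.β) by field_simp, inv_eq_one_div,
    div_le_div_iff₀ (by positivity) (by positivity)]
  nlinarith

theorem inv_η_le (h : Admissible I L₂) (hs : r.Successful) (k : ℕ) :
    (r.η k)⁻¹ ≤ 5 * I.L₁ / (I.α₂ * I.β) := by
  have := h.α₂_pos; have := h.β_pos; have := h.L₁_pos
  have hbt : ∀ k, r.rej k ≠ 0 → (r.η k)⁻¹ ≤ 5 * I.L₁ / (I.α₂ * I.β) := fun k hk => by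
    refine (r.inv_η_le_playedRes h hk).trans ?_
    calc _ ≤ I.L₁ / (I.α₂ * I.β) * 5 := by gcongr; exact r.playedRes_le h hs k
      _ = _ := by ring
  have hkeep : ∀ k, r.rej k = 0 → r.η k = r.σ k := fun k hk => by simp [η, hk]
  induction k with
  | zero =>
    by_cases hk : r.rej 0 = 0
    · rw [hkeep 0 hk, r.σ_zero]
      have := inv_anti₀ (by positivity) h.σ₀_ge
      rwa [inv_div] at this
    · exact hbt 0 hk
  | succ k ih =>
    by_cases hk : r.rej (k + 1) = 0
    · rw [hkeep _ hk, r.σ_succ]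
      refine le_trans (inv_anti₀ (r.η_pos h k) ?_) ih
      rw [le_div_iff₀ h.β_pos]
      exact mul_le_of_le_one_right (r.η_pos h k).le h.β_lt.le
    · exact hbt _ hk

/-- Only backtracking iterations contribute to the sum of inverse step sizes, up to the factor
`1 / (1 - β)`, because the step size grows by the factor `1 / β` at the others. -/
theorem sum_inv_η_le (h : Admissible I L₂) (N : ℕ) :
    (1 - I.β) * ∑ i ∈ Finset.range N, (r.η i)⁻¹ ≤
      I.L₁ / (I.α₂ * I.β) * (5 + ∑ i ∈ Finset.range N, r.playedRes i) := by
  have := h.α₂_pos; have := h.β_pos; have := h.L₁_pos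
  have key : ∀ N, (1 - I.β) * ∑ i ∈ Finset.range N, (r.η i)⁻¹ + (r.σ N)⁻¹ ≤
      I.L₁ / (I.α₂ * I.β) * (5 + ∑ i ∈ Finset.range N, r.playedRes i) := by
    intro N
    induction N with
    | zero =>
      have h1 := inv_anti₀ (by positivity) h.σ₀_ge
      rw [inv_div] at h1
      simp only [Finset.range_zero, Finset.sum_empty, mul_zero, zero_add, add_zero, r.σ_zero]
      exact h1.trans (le_of_eq (by ring))
    | succ n ih =>
      rw [Finset.sum_range_succ, Finset.sum_range_succ]
      have h1 : (r.σ (n + 1))⁻¹ = I.β * (r.η n)⁻¹ := by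
        rw [r.σ_succ, inv_div, div_eq_mul_inv]; rfl
      have h2 : (r.η n)⁻¹ ≤ (r.σ n)⁻¹ + I.L₁ / (I.α₂ * I.β) * r.playedRes n := by
        by_cases hk : r.rej n = 0
        · simp [η, hk, playedRes]
        · linarith [r.inv_η_le_playedRes h hk, inv_pos.mpr (r.σ_pos h n)]
      rw [h1]
      linarith
  linarith [key N, inv_pos.mpr (r.σ_pos h N)]

theorem jacRes_sq_le (h : Admissible I L₂) (hs : r.Successful) (k : ℕ) :
    r.jacRes k ^ 2 ≤ ((1 + I.α₁) * L₂ / (2 * I.β * (1 - I.α₁) * I.L₁)) ^ 2 *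
      ‖r.zhat k - r.z k‖ ^ 2 := by
  have := h.α₁_pos; have := h.β_pos; have := h.L₁_pos; have := h.L₂_nonneg
  have hα : 0 < 1 - I.α₁ := by linarith [h.α₁_lt]
  unfold jacRes
  split_ifs with hk
  · rw [zero_pow two_ne_zero]; positivity
  · have hs0 : 0 < ‖r.rejStep k‖ := norm_pos_iff.mpr (r.rejStep_ne_zero hk)
    rw [← mul_pow]
    refine pow_le_pow_left₀ (by positivity) ?_ 2
    have h1 := norm_taylor_le h.diff h.lip_fderiv (r.z k) (r.rejStep k)
    rw [← mv_jac, rejStep, add_sub_cancel] at h1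
    change ‖r.rejDiff k - mv (jac I.F (r.z k)) (r.rejStep k)‖ ≤ L₂ / 2 * ‖r.rejStep k‖ ^ 2 at h1
    have h2 := r.norm_rejStep_le h hs hk
    have h3 : ‖r.rejStep k‖ ≤ (1 + I.α₁) / (I.β * (1 - I.α₁)) * ‖r.zhat k - r.z k‖ := by
      rw [div_mul_eq_mul_div, le_div_iff₀ (by positivity)]; linarith
    calc _ ≤ L₂ / 2 * ‖r.rejStep k‖ ^ 2 / (I.L₁ * ‖r.rejStep k‖) := by gcongr
      _ = L₂ / (2 * I.L₁) * ‖r.rejStep k‖ := by field_simp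
      _ ≤ L₂ / (2 * I.L₁) * ((1 + I.α₁) / (I.β * (1 - I.α₁)) * ‖r.zhat k - r.z k‖) := by gcongr
      _ = _ := by field_simp

theorem sum_jacRes_sq_le (h : Admissible I L₂) (hs : r.Successful) {zs : Vec d}
    (hzs : I.F zs = 0) (N : ℕ) :
    2 * ∑ i ∈ Finset.range N, r.jacRes i ^ 2 ≤
      constC I.α₁ I.α₂ I.β * (L₂ * ‖I.z₀ - zs‖ / I.L₁) ^ 2 := by
  have := h.α₁_pos; have := h.α₂_pos; have := h.β_pos; have := h.L₁_pos; have := h.L₂_nonneg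
  have hα : 0 < 1 - I.α₁ := by linarith [h.α₁_lt]
  have hα2 : 0 < 1 - (I.α₁ + I.α₂) := by linarith [h.α₁_lt, h.α₂_lt]
  set c := ((1 + I.α₁) * L₂ / (2 * I.β * (1 - I.α₁) * I.L₁)) ^ 2 with hc
  have h1 : ∑ i ∈ Finset.range N, r.jacRes i ^ 2 ≤
      c * ∑ i ∈ Finset.range N, ‖r.zhat i - r.z i‖ ^ 2 := by
    rw [Finset.mul_sum]
    exact Finset.sum_le_sum fun i _ => r.jacRes_sq_le h hs i
  have h2 := r.sum_norm_sq_le h hzs N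
  set T := ∑ i ∈ Finset.range N, ‖r.zhat i - r.z i‖ ^ 2
  have hT : 0 ≤ T := Finset.sum_nonneg fun i _ => sq_nonneg _
  have h3 : T ≤ ‖I.z₀ - zs‖ ^ 2 / (1 - (I.α₁ + I.α₂)) := by
    rw [le_div_iff₀ hα2]
    nlinarith [mul_nonneg hT (mul_nonneg (add_pos ‹0 < I.α₁› ‹0 < I.α₂›).le hα2.le)]
  calc 2 * ∑ i ∈ Finset.range N, r.jacRes i ^ 2
      ≤ 2 * (c * (‖I.z₀ - zs‖ ^ 2 / (1 - (I.α₁ + I.α₂)))) := by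
        gcongr; exact h1.trans (by gcongr)
    _ = constC I.α₁ I.α₂ I.β * (L₂ * ‖I.z₀ - zs‖ / I.L₁) ^ 2 := by
        rw [hc, constC]; field_simp

end Run

/-! ### Dynamic regret and the step sizes -/

/-- Moving the comparator within a ball changes the squared distance to a point of that ball by at
most `4 R` times the length of the move. -/
theorem norm_sub_sq_le_of_move {V : Type*} [NormedAddCommGroup V] [InnerProductSpace ℝ V]
    {R : ℝ} {w x y : V} (hw : ‖w‖ ≤ R) (hx : ‖x‖ ≤ R) (hy : ‖y‖ ≤ R) :
    ‖w - y‖ ^ 2 ≤ ‖w - x‖ ^ 2 + 4 * R * ‖y - x‖ := by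
  have h1 : ‖w - y‖ ≤ ‖w - x‖ + ‖y - x‖ := by
    have := norm_sub_le (w - x) (y - x)
    rwa [sub_sub_sub_cancel_right] at this
  have h2 : ‖w - y‖ ≤ 2 * R := (norm_sub_le _ _).trans (by linarith)
  have h3 : ‖w - x‖ ≤ 2 * R := (norm_sub_le _ _).trans (by linarith)
  nlinarith [norm_nonneg (w - y), norm_nonneg (w - x), norm_nonneg (y - x)]

namespace Run

variable {I : Input d} {L₂ : ℝ} (r : Run I)

/-- Squared distance of the learner's auxiliary iterate from the comparator at `z_k`. -/
noncomputable def potential (k : ℕ) : ℝ :=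
  ‖toVec (r.W (r.round k)) - toVec (comparator I (r.z k))‖ ^ 2

theorem norm_comparator_sub_le (h : Admissible I L₂) (z z' : Vec d) :
    ‖toVec (comparator I z) - toVec (comparator I z')‖ ≤
      Real.sqrt d * (L₂ / I.L₁ * ‖z - z'‖) := by
  refine (frobNorm_centered_sub_le h.L₁_pos _ _).trans ?_
  have h1 : opNorm (jac I.F z - jac I.F z') ≤ L₂ * ‖z - z'‖ := by
    refine le_trans (le_of_eq ?_) (h.lip_fderiv z z')
    simp [opNorm, jac]
  have := h.L₁_pos
  calc _ ≤ Real.sqrt d * (L₂ * ‖z - z'‖ / I.L₁) := by gcongr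
    _ = _ := by ring

/-- Change of the potential in one iteration, with `4ab ≤ a² / 2 + 8b²` and
`12δa ≤ a² / 8 + 288δ²`. The accuracies sum to a telescoping series of square roots. -/
theorem potential_succ_le (h : Admissible I L₂) (hs : r.Successful) (k : ℕ) :
    121 * r.potential (k + 1) + 19 / 8 * r.playedRes k ^ 2 + 144 * Real.sqrt (r.round k) ≤
      121 * r.potential k + 8 * r.jacRes k ^ 2 + 144 * Real.sqrt (r.round (k + 1)) +
        1452 * d * (L₂ / I.L₁) * ‖r.z (k + 1) - r.z k‖ := by
  have hR := h.R_nonneg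
  have hL1 := h.L₁_pos
  have hL2 := h.L₂_nonneg
  have hx : ∀ z, ‖toVec (comparator I z)‖ ≤ I.R := fun z => by
    rw [← frobNorm_eq]; exact h.R_ge _ (h.comparator_mem z)
  have hmove : 121 * r.potential (k + 1) ≤
      121 * ‖toVec (r.W (r.round (k + 1))) - toVec (comparator I (r.z k))‖ ^ 2 +
        1452 * d * (L₂ / I.L₁) * ‖r.z (k + 1) - r.z k‖ := by
    have h1 := norm_sub_sq_le_of_move (R := I.R) (w := toVec (r.W (r.round (k + 1))))
      (by rw [← frobNorm_eq]; exact (r.W_mem h (k + 1)).2) (hx (r.z k)) (hx (r.z (k + 1)))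
    have h2 : 4 * I.R * ‖toVec (comparator I (r.z (k + 1))) - toVec (comparator I (r.z k))‖ ≤
        4 * (3 * Real.sqrt d) * (Real.sqrt d * (L₂ / I.L₁ * ‖r.z (k + 1) - r.z k‖)) := by
      gcongr
      · exact h.R_le
      · exact norm_comparator_sub_le h _ _
    have h3 : 4 * (3 * Real.sqrt d) * (Real.sqrt d * (L₂ / I.L₁ * ‖r.z (k + 1) - r.z k‖)) =
        12 * d * (L₂ / I.L₁) * ‖r.z (k + 1) - r.z k‖ := by
      rw [show 4 * (3 * Real.sqrt d) * (Real.sqrt d * (L₂ / I.L₁ * ‖r.z (k + 1) - r.z k‖)) =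
        12 * Real.sqrt d ^ 2 * (L₂ / I.L₁) * ‖r.z (k + 1) - r.z k‖ by ring,
        Real.sq_sqrt (Nat.cast_nonneg d)]
    unfold potential
    linarith
  have hround := r.round_succ k
  by_cases hk : r.rej k = 0
  · rw [if_pos hk] at hround
    rw [hround] at hmove ⊢
    simp only [playedRes, jacRes, if_pos hk]
    have : r.potential k = ‖toVec (r.W (r.round k)) - toVec (comparator I (r.z k))‖ ^ 2 := rfl
    rw [this]
    linarith
  · rw [if_neg hk] at hround
    have h1 := r.learner_regret h hs k hk rfl rfl (r.rejStep_ne_zero hk)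
    have ha : r.playedRes k = ‖r.rejDiff k - mv (r.B (r.round k)) (r.rejStep k)‖ /
        (I.L₁ * ‖r.rejStep k‖) := if_neg hk
    have hb : r.jacRes k = ‖r.rejDiff k - mv (jac I.F (r.z k)) (r.rejStep k)‖ /
        (I.L₁ * ‖r.rejStep k‖) := if_neg hk
    change 121 * ‖toVec (r.W (r.round k + 1)) - toVec (comparator I (r.z k))‖ ^ 2 ≤
      121 * r.potential k
        - (3 * (‖r.rejDiff k - mv (r.B (r.round k)) (r.rejStep k)‖ /
            (I.L₁ * ‖r.rejStep k‖)) ^ 2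
        - 4 * (‖r.rejDiff k - mv (r.B (r.round k)) (r.rejStep k)‖ / (I.L₁ * ‖r.rejStep k‖)) *
          (‖r.rejDiff k - mv (jac I.F (r.z k)) (r.rejStep k)‖ / (I.L₁ * ‖r.rejStep k‖))
        - 12 * I.acc (r.round k) *
          (‖r.rejDiff k - mv (r.B (r.round k)) (r.rejStep k)‖ / (I.L₁ * ‖r.rejStep k‖))) at h1
    rw [← ha, ← hb] at h1
    have h2 := h.acc_sq_le (r.round k)
    rw [hround] at hmove ⊢
    have h3 : 4 * r.playedRes k * r.jacRes k ≤ r.playedRes k ^ 2 / 2 + 8 * r.jacRes k ^ 2 := by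
      linarith [sq_nonneg (r.playedRes k - 4 * r.jacRes k)]
    have h4 : 12 * I.acc (r.round k) * r.playedRes k ≤
        r.playedRes k ^ 2 / 8 + 288 * I.acc (r.round k) ^ 2 := by
      linarith [sq_nonneg (r.playedRes k - 48 * I.acc (r.round k))]
    linarith

theorem round_le (k : ℕ) : r.round k ≤ k := by
  induction k with
  | zero => exact r.round_zero.le
  | succ k ih => rw [r.round_succ]; split_ifs <;> omega

theorem potential_zero (h : Admissible I L₂) :
    r.potential 0 = (frobNorm (I.B₀ - jac I.F I.z₀) / I.L₁) ^ 2 := by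
  have e : r.W 0 - comparator I (r.z 0) = I.L₁⁻¹ • (I.B₀ - jac I.F I.z₀) := by
    rw [r.W_zero_eq, r.z_zero, comparator, centered, centered, ← smul_sub]
    congr 1; abel
  rw [potential, r.round_zero, ← map_sub, e, map_smul, norm_smul, frobNorm_eq,
    Real.norm_of_nonneg (inv_pos.mpr h.L₁_pos).le]
  ring

theorem sum_playedRes_sq_le (h : Admissible I L₂) (hs : r.Successful) {zs : Vec d}
    (hzs : I.F zs = 0) (N : ℕ) :
    ∑ i ∈ Finset.range N, r.playedRes i ^ 2 ≤
      162 * (frobNorm (I.B₀ - jac I.F I.z₀) / I.L₁) ^ 2 +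
      2 * constC I.α₁ I.α₂ I.β * (L₂ * ‖I.z₀ - zs‖ / I.L₁) ^ 2 +
      (648 * Real.sqrt 2 * d * L₂ * ‖I.z₀ - zs‖ / (Real.sqrt (1 - I.α₁ - I.α₂) * I.L₁) + 72) *
        Real.sqrt N := by
  have hL1 := h.L₁_pos
  have hL2 := h.L₂_nonneg
  have key : ∀ N, 121 * r.potential N + 19 / 8 * ∑ i ∈ Finset.range N, r.playedRes i ^ 2 ≤
      121 * r.potential 0 + 8 * ∑ i ∈ Finset.range N, r.jacRes i ^ 2 +
      144 * Real.sqrt (r.round N) +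
      1452 * d * (L₂ / I.L₁) * ∑ i ∈ Finset.range N, ‖r.z (i + 1) - r.z i‖ := by
    intro N
    induction N with
    | zero => simp [r.round_zero]
    | succ n ih =>
      simp only [Finset.sum_range_succ, mul_add]
      linarith [r.potential_succ_le h hs n]
  have h1 := key N
  have h2 := r.sum_jacRes_sq_le h hs hzs N
  have h3 : Real.sqrt (r.round N) ≤ Real.sqrt N :=
    Real.sqrt_le_sqrt (Nat.cast_le.mpr (r.round_le N))
  have h4 : 1452 * d * (L₂ / I.L₁) * ∑ i ∈ Finset.range N, ‖r.z (i + 1) - r.z i‖ ≤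
      1452 * d * (L₂ / I.L₁) *
        (Real.sqrt N * (Real.sqrt 2 * ‖I.z₀ - zs‖ / Real.sqrt (1 - I.α₁ - I.α₂))) := by
    gcongr; exact r.sum_norm_z_succ_sub_le h hzs N
  have h5 : 0 ≤ r.potential N := sq_nonneg _
  rw [r.potential_zero h] at h1
  have h6 : 0 ≤ 2 * constC I.α₁ I.α₂ I.β * (L₂ * ‖I.z₀ - zs‖ / I.L₁) ^ 2 := by
    have : 0 ≤ ∑ i ∈ Finset.range N, r.jacRes i ^ 2 := Finset.sum_nonneg fun i _ => sq_nonneg _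
    linarith
  set q := Real.sqrt 2 * d * L₂ * ‖I.z₀ - zs‖ / (Real.sqrt (1 - I.α₁ - I.α₂) * I.L₁) with hq
  have hq0 : 0 ≤ q := by positivity
  have e1 : 648 * Real.sqrt 2 * d * L₂ * ‖I.z₀ - zs‖ / (Real.sqrt (1 - I.α₁ - I.α₂) * I.L₁)
      = 648 * q := by rw [hq]; ring
  have e2 : 1452 * d * (L₂ / I.L₁) *
      (Real.sqrt N * (Real.sqrt 2 * ‖I.z₀ - zs‖ / Real.sqrt (1 - I.α₁ - I.α₂))) =
      1452 * (q * Real.sqrt N) := by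
    rw [hq, div_mul_eq_mul_div, mul_comm (Real.sqrt (1 - I.α₁ - I.α₂)), ← div_div]; ring
  rw [e1]
  rw [e2] at h4
  have h7 : 0 ≤ q * Real.sqrt N := by positivity
  linarith [sq_nonneg (frobNorm (I.B₀ - jac I.F I.z₀) / I.L₁), Real.sqrt_nonneg (N : ℝ)]

theorem constC_nonneg (h : Admissible I L₂) : 0 ≤ constC I.α₁ I.α₂ I.β := by
  have : 0 < 1 - (I.α₁ + I.α₂) := by linarith [h.α₁_lt, h.α₂_lt]
  unfold constC; positivity

theorem sum_playedRes_le (h : Admissible I L₂) (hs : r.Successful) {zs : Vec d}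
    (hzs : I.F zs = 0) (N : ℕ) :
    ∑ i ∈ Finset.range N, r.playedRes i ≤
      Q₁ I L₂ zs * (N : ℝ) ^ (1 / 2 : ℝ) + Q₂ I L₂ zs * (N : ℝ) ^ (3 / 4 : ℝ) := by
  have hL1 := h.L₁_pos
  have hL2 := h.L₂_nonneg
  have hC := constC_nonneg h
  set ν := (N : ℝ) ^ (1 / 4 : ℝ) with hν
  have hν0 : 0 ≤ ν := by positivity
  have e2 : (N : ℝ) ^ (1 / 2 : ℝ) = ν ^ 2 := by
    rw [hν, ← Real.rpow_mul_natCast (Nat.cast_nonneg N)]; norm_num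
  have e3 : (N : ℝ) ^ (3 / 4 : ℝ) = ν ^ 3 := by
    rw [hν, ← Real.rpow_mul_natCast (Nat.cast_nonneg N)]; norm_num
  have e4 : (N : ℝ) = ν ^ 4 := by
    rw [hν, ← Real.rpow_mul_natCast (Nat.cast_nonneg N)]; norm_num
  have h1 := r.sum_playedRes_sq_le h hs hzs N
  rw [Real.sqrt_eq_rpow (N : ℝ), e2] at h1
  have h2 : (∑ i ∈ Finset.range N, r.playedRes i) ^ 2 ≤
      N * ∑ i ∈ Finset.range N, r.playedRes i ^ 2 := by
    simpa using sq_sum_le_card_mul_sum_sq (s := Finset.range N) (f := r.playedRes)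
  set A := 9 * Real.sqrt 2 * (frobNorm (I.B₀ - jac I.F I.z₀) / I.L₁) with hA
  set E := Real.sqrt (2 * constC I.α₁ I.α₂ I.β) * (L₂ * ‖I.z₀ - zs‖ / I.L₁) with hE
  set G := Real.sqrt (648 * Real.sqrt 2 * d * L₂ * ‖I.z₀ - zs‖ /
    (Real.sqrt (1 - I.α₁ - I.α₂) * I.L₁)) with hG
  have hA2 : A ^ 2 = 162 * (frobNorm (I.B₀ - jac I.F I.z₀) / I.L₁) ^ 2 := by
    rw [hA, mul_pow, mul_pow, Real.sq_sqrt (by norm_num)]; norm_num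
  have hE2 : E ^ 2 = 2 * constC I.α₁ I.α₂ I.β * (L₂ * ‖I.z₀ - zs‖ / I.L₁) ^ 2 := by
    rw [hE, mul_pow, Real.sq_sqrt (by positivity)]
  have hG2 : G ^ 2 = 648 * Real.sqrt 2 * d * L₂ * ‖I.z₀ - zs‖ /
    (Real.sqrt (1 - I.α₁ - I.α₂) * I.L₁) := by
    rw [hG, Real.sq_sqrt (by positivity)]
  have hH2 : (6 * Real.sqrt 2) ^ 2 = (72 : ℝ) := by
    rw [mul_pow, Real.sq_sqrt (by norm_num)]; norm_num
  have hA0 : 0 ≤ A := by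
    have : 0 ≤ frobNorm (I.B₀ - jac I.F I.z₀) := Real.sqrt_nonneg _
    positivity
  have hE0 : 0 ≤ E := by positivity
  have hG0 : 0 ≤ G := Real.sqrt_nonneg _
  have hH0 : 0 ≤ 6 * Real.sqrt 2 := by positivity
  have eQ1 : Q₁ I L₂ zs = A + E := rfl
  have eQ2 : Q₂ I L₂ zs = G + 6 * Real.sqrt 2 := rfl
  rw [← hA2, ← hE2, ← hG2, ← hH2] at h1
  rw [eQ1, eQ2, e2, e3]
  set H := 6 * Real.sqrt 2
  apply le_of_sq_le_sq _ (by positivity)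
  have h3 : A ^ 2 + E ^ 2 + (G ^ 2 + H ^ 2) * ν ^ 2 ≤ ((A + E) + (G + H) * ν) ^ 2 := by
    have : 0 ≤ 2 * (A * E) + 2 * (G * H) * ν ^ 2 + 2 * (A + E) * ((G + H) * ν) := by positivity
    nlinarith
  calc _ ≤ ν ^ 4 * ((A + E) + (G + H) * ν) ^ 2 := by
        rw [e4] at h2
        exact h2.trans (mul_le_mul_of_nonneg_left (h1.trans h3) (by positivity))
    _ = _ := by ring

theorem sum_η_pos (h : Admissible I L₂) {k : ℕ} (hk : 1 ≤ k) :
    0 < ∑ i ∈ Finset.range k, r.η i :=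
  Finset.sum_pos (fun i _ => r.η_pos h i) ⟨0, Finset.mem_range.mpr hk⟩

theorem maxDistSq_nonneg (z₀ : Vec d) (D : Set (Vec d)) : 0 ≤ maxDistSq z₀ D := by
  apply Real.sSup_nonneg
  rintro _ ⟨z, -, rfl⟩
  positivity

/-- The gap in terms of the inverse step sizes, from the harmonic-arithmetic mean inequality. -/
theorem gap_le_of_sum_inv (h : Admissible I L₂) (P : Problem I.F) {D : Set (Vec d)}
    (hD : IsCompact D) (hne : D.Nonempty) {k : ℕ} (hk : 1 ≤ k) {T : ℝ}
    (hT : ∑ i ∈ Finset.range k, (r.η i)⁻¹ ≤ T) :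
    P.gap D (r.avg k) ≤ maxDistSq I.z₀ D * T / (2 * (k : ℝ) ^ 2) := by
  have hk0 : (0 : ℝ) < k := by exact_mod_cast hk
  have hS := r.sum_η_pos h hk
  have hM := maxDistSq_nonneg I.z₀ D
  have h1 := P.gap_average_le h.mono hD hne I.z₀ (Finset.range k) r.η r.zhat
    (fun i _ => (r.η_pos h i).le) hS (r.sum_linearized_gap_le h k)
  have h2 : (k : ℝ) ^ 2 ≤ (∑ i ∈ Finset.range k, r.η i) * ∑ i ∈ Finset.range k, (r.η i)⁻¹ := by
    have := Finset.sum_sq_le_sum_mul_sum_of_sq_le_mul (Finset.range k) (r := fun _ => (1 : ℝ))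
      (f := r.η) (g := fun i => (r.η i)⁻¹) (fun i _ => (r.η_pos h i).le)
      (fun i _ => (inv_pos.mpr (r.η_pos h i)).le)
      (fun i _ => by rw [mul_inv_cancel₀ (r.η_pos h i).ne', one_pow])
    simpa using this
  refine h1.trans ?_
  have h3 : (k : ℝ) ^ 2 ≤ (∑ i ∈ Finset.range k, r.η i) * T :=
    h2.trans (mul_le_mul_of_nonneg_left hT hS.le)
  rw [div_le_div_iff₀ (by positivity) (by positivity)]
  nlinarith [mul_le_mul_of_nonneg_left h3 hM]

theorem gap_le_linear (h : Admissible I L₂) (hs : r.Successful) (P : Problem I.F)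
    {D : Set (Vec d)} (hD : IsCompact D) (hne : D.Nonempty) {k : ℕ} (hk : 1 ≤ k) :
    P.gap D (r.avg k) ≤ 5 * I.L₁ * maxDistSq I.z₀ D / (2 * I.α₂ * I.β * k) := by
  have hk0 : (0 : ℝ) < k := by exact_mod_cast hk
  have := h.α₂_pos; have := h.β_pos
  have hT : ∑ i ∈ Finset.range k, (r.η i)⁻¹ ≤ k * (5 * I.L₁ / (I.α₂ * I.β)) := by
    simpa using Finset.sum_le_card_nsmul (Finset.range k) (fun i => (r.η i)⁻¹) _
      (fun i _ => r.inv_η_le h hs i)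
  refine (r.gap_le_of_sum_inv h P hD hne hk hT).trans (le_of_eq ?_)
  field_simp

theorem gap_le_superlinear (h : Admissible I L₂) (hs : r.Successful) (P : Problem I.F)
    {D : Set (Vec d)} (hD : IsCompact D) (hne : D.Nonempty) {k : ℕ} (hk : 1 ≤ k) {zs : Vec d}
    (hzs : I.F zs = 0) :
    P.gap D (r.avg k) ≤ I.L₁ * maxDistSq I.z₀ D / (2 * (1 - I.β) * I.α₂ * I.β) *
      (5 / (k : ℝ) ^ 2 + Q₁ I L₂ zs / (k : ℝ) ^ (1.5 : ℝ) +
        Q₂ I L₂ zs / (k : ℝ) ^ (1.25 : ℝ)) := by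
  have hk0 : (0 : ℝ) < k := by exact_mod_cast hk
  have := h.α₂_pos; have := h.β_pos; have := h.L₁_pos
  have hβ : 0 < 1 - I.β := by linarith [h.β_lt]
  have hT : ∑ i ∈ Finset.range k, (r.η i)⁻¹ ≤ I.L₁ / (I.α₂ * I.β) *
      (5 + (Q₁ I L₂ zs * (k : ℝ) ^ (1 / 2 : ℝ) + Q₂ I L₂ zs * (k : ℝ) ^ (3 / 4 : ℝ))) /
      (1 - I.β) := by
    rw [le_div_iff₀' hβ]
    refine (r.sum_inv_η_le h k).trans ?_
    gcongr
    exact r.sum_playedRes_le h hs hzs k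
  refine (r.gap_le_of_sum_inv h P hD hne hk hT).trans (le_of_eq ?_)
  have e1 : (k : ℝ) ^ (1.5 : ℝ) = (k : ℝ) ^ 2 / (k : ℝ) ^ (1 / 2 : ℝ) := by
    rw [← Real.rpow_natCast, ← Real.rpow_sub hk0]; norm_num
  have e2 : (k : ℝ) ^ (1.25 : ℝ) = (k : ℝ) ^ 2 / (k : ℝ) ^ (3 / 4 : ℝ) := by
    rw [← Real.rpow_natCast, ← Real.rpow_sub hk0]; norm_num
  rw [e1, e2]
  field_simp
  ring

end Run

/-! ### Constants independent of the dimension -/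

/-- A constant for the bounds on `Q₁` and `Q₂`. -/
noncomputable def coeffConst (α₁ α₂ β : ℝ) : ℝ :=
  (18 * Real.sqrt 2 + Real.sqrt (2 * constC α₁ α₂ β)) +
    (Real.sqrt (648 * Real.sqrt 2 / Real.sqrt (1 - α₁ - α₂)) + 6 * Real.sqrt 2)

/-- A constant for all bounds in terms of `L₂ * ‖z₀ - zs‖ / L₁`. -/
noncomputable def rateConst (α₁ α₂ β : ℝ) : ℝ :=
  coeffConst α₁ α₂ β + 5 / (2 * α₂ * β) +
    (5 + 3 * coeffConst α₁ α₂ β) / (2 * (1 - β) * α₂ * β)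

theorem coeffConst_pos (α₁ α₂ β : ℝ) : 0 < coeffConst α₁ α₂ β := by
  unfold coeffConst; positivity

theorem coeffConst_le_rateConst {α₁ α₂ β : ℝ} (hα₂ : 0 < α₂) (hβ : 0 < β) (hβ1 : β < 1) :
    coeffConst α₁ α₂ β ≤ rateConst α₁ α₂ β := by
  have h1 := coeffConst_pos α₁ α₂ β
  have h2 : 0 < 1 - β := by linarith
  have h3 : 0 ≤ 5 / (2 * α₂ * β) := by positivity
  have h4 : 0 ≤ (5 + 3 * coeffConst α₁ α₂ β) / (2 * (1 - β) * α₂ * β) := by positivity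
  unfold rateConst; linarith

variable {I : Input d} {L₂ : ℝ}

theorem Q₁_le (h : Admissible I L₂) (zs : Vec d) :
    Q₁ I L₂ zs ≤ coeffConst I.α₁ I.α₂ I.β * (Real.sqrt d + L₂ * ‖I.z₀ - zs‖ / I.L₁) := by
  have hL1 := h.L₁_pos
  have hL2 := h.L₂_nonneg
  have h1 : frobNorm (I.B₀ - jac I.F I.z₀) / I.L₁ ≤ 2 * Real.sqrt d := by
    rw [div_le_iff₀ hL1]
    calc _ ≤ Real.sqrt d * opNorm (I.B₀ - jac I.F I.z₀) := frobNorm_le_sqrt_mul_opNorm _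
      _ ≤ Real.sqrt d * (I.L₁ + I.L₁) := by
        gcongr
        exact (opNorm_sub_le _ _).trans
          (add_le_add h.B₀_mem.2.2.1 (opNorm_jac_le hL1 h.lip I.z₀))
      _ = _ := by ring
  set lam := L₂ * ‖I.z₀ - zs‖ / I.L₁ with hlam
  have hlam0 : 0 ≤ lam := by positivity
  set E := Real.sqrt (2 * constC I.α₁ I.α₂ I.β) with hE
  set G := Real.sqrt (648 * Real.sqrt 2 / Real.sqrt (1 - I.α₁ - I.α₂))
  have hE0 : 0 ≤ E := Real.sqrt_nonneg _
  have e : Q₁ I L₂ zs = 9 * Real.sqrt 2 * (frobNorm (I.B₀ - jac I.F I.z₀) / I.L₁) + E * lam := rfl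
  have e2 : coeffConst I.α₁ I.α₂ I.β = (18 * Real.sqrt 2 + E) + (G + 6 * Real.sqrt 2) := rfl
  rw [e, e2]
  have h2 : 9 * Real.sqrt 2 * (frobNorm (I.B₀ - jac I.F I.z₀) / I.L₁) ≤
      9 * Real.sqrt 2 * (2 * Real.sqrt d) := by gcongr
  have h3 : 0 ≤ 18 * Real.sqrt 2 * lam + E * Real.sqrt d +
      (G + 6 * Real.sqrt 2) * (Real.sqrt d + lam) := by positivity
  linarith

theorem Q₂_le (h : Admissible I L₂) (zs : Vec d) :
    Q₂ I L₂ zs ≤ coeffConst I.α₁ I.α₂ I.β *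
      (Real.sqrt (d * L₂ * ‖I.z₀ - zs‖ / I.L₁) + 1) := by
  have hL1 := h.L₁_pos
  have hL2 := h.L₂_nonneg
  set E := Real.sqrt (2 * constC I.α₁ I.α₂ I.β)
  set G := Real.sqrt (648 * Real.sqrt 2 / Real.sqrt (1 - I.α₁ - I.α₂)) with hG
  have e : Q₂ I L₂ zs = G * Real.sqrt (d * L₂ * ‖I.z₀ - zs‖ / I.L₁) + 6 * Real.sqrt 2 := by
    rw [Q₂, hG, ← Real.sqrt_mul (by positivity), div_mul_div_comm]
    congr 3; ring
  have e2 : coeffConst I.α₁ I.α₂ I.β = (18 * Real.sqrt 2 + E) + (G + 6 * Real.sqrt 2) := rfl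
  rw [e, e2]
  set x := Real.sqrt (d * L₂ * ‖I.z₀ - zs‖ / I.L₁)
  have : 0 ≤ (18 * Real.sqrt 2 + E) * (x + 1) + G + 6 * Real.sqrt 2 * x := by positivity
  linarith

theorem rate_le {K w lam x y k : ℝ} (hK : 0 ≤ K) (hw : 1 ≤ w) (hlam : 0 ≤ lam) (hk : 1 ≤ k)
    (hx : x ≤ K * (w + lam)) (hy : y ≤ K * (w * Real.sqrt lam + 1)) :
    5 / k ^ 2 + x / k ^ (1.5 : ℝ) + y / k ^ (1.25 : ℝ) ≤
      (5 + 3 * K) * (1 + lam) * (w / k ^ (1.25 : ℝ)) := by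
  have hp : 0 < k ^ (1.25 : ℝ) := by positivity
  have h1 : k ^ (1.25 : ℝ) ≤ k ^ 2 := by
    rw [← Real.rpow_natCast]
    exact Real.rpow_le_rpow_of_exponent_le hk (by norm_num)
  have h2 : k ^ (1.25 : ℝ) ≤ k ^ (1.5 : ℝ) :=
    Real.rpow_le_rpow_of_exponent_le hk (by norm_num)
  have hs : Real.sqrt lam ≤ 1 + lam := by
    nlinarith [Real.sq_sqrt hlam, sq_nonneg (Real.sqrt lam - 1), Real.sqrt_nonneg lam]
  have h3 : 5 / k ^ 2 ≤ 5 / k ^ (1.25 : ℝ) := by gcongr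
  have h4 : x / k ^ (1.5 : ℝ) ≤ K * (w + lam) / k ^ (1.25 : ℝ) := by gcongr
  have h5 : y / k ^ (1.25 : ℝ) ≤ K * (w * Real.sqrt lam + 1) / k ^ (1.25 : ℝ) := by gcongr
  have h6 : 5 + K * (w + lam) + K * (w * Real.sqrt lam + 1) ≤ (5 + 3 * K) * (1 + lam) * w := by
    have hwl : lam ≤ w * lam := le_mul_of_one_le_left hlam hw
    have a1 : w + lam ≤ (1 + lam) * w := by linarith
    have a2 : w * Real.sqrt lam + 1 ≤ 2 * ((1 + lam) * w) := by
      nlinarith [mul_le_mul_of_nonneg_left hs (by linarith : (0 : ℝ) ≤ w)]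
    have a3 : 1 ≤ (1 + lam) * w := by linarith
    nlinarith [mul_le_mul_of_nonneg_left a1 hK, mul_le_mul_of_nonneg_left a2 hK]
  calc _ ≤ (5 + K * (w + lam) + K * (w * Real.sqrt lam + 1)) / k ^ (1.25 : ℝ) := by
        rw [add_div, add_div]; linarith
    _ ≤ (5 + 3 * K) * (1 + lam) * w / k ^ (1.25 : ℝ) := by gcongr
    _ = _ := by ring

theorem Run.gap_le_rate (r : Run I) (h : Admissible I L₂) (hs : r.Successful) (P : Problem I.F)
    {D : Set (Vec d)} (hD : IsCompact D) (hne : D.Nonempty) {k : ℕ} (hk : 1 ≤ k) {zs : Vec d}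
    (hzs : I.F zs = 0) :
    P.gap D (r.avg k) ≤ rateConst I.α₁ I.α₂ I.β * (1 + L₂ * ‖I.z₀ - zs‖ / I.L₁) * I.L₁ *
      maxDistSq I.z₀ D * min (1 / (k : ℝ)) (Real.sqrt d / (k : ℝ) ^ (1.25 : ℝ)) := by
  have hL1 := h.L₁_pos
  have hL2 := h.L₂_nonneg
  have hα := h.α₂_pos
  have hβ := h.β_pos
  have hβ1 : 0 < 1 - I.β := by linarith [h.β_lt]
  have hk1 : (1 : ℝ) ≤ k := by exact_mod_cast hk
  have hM := Run.maxDistSq_nonneg I.z₀ D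
  have hK := coeffConst_pos I.α₁ I.α₂ I.β
  have hlin := r.gap_le_linear h hs P hD hne hk
  set K := coeffConst I.α₁ I.α₂ I.β with hKdef
  set lam := L₂ * ‖I.z₀ - zs‖ / I.L₁ with hlam
  have hlam0 : 0 ≤ lam := by positivity
  set M := maxDistSq I.z₀ D with hMdef
  have hc : rateConst I.α₁ I.α₂ I.β = K + 5 / (2 * I.α₂ * I.β) +
    (5 + 3 * K) / (2 * (1 - I.β) * I.α₂ * I.β) := rfl
  have hc1 : 0 ≤ 5 / (2 * I.α₂ * I.β) := by positivity
  have hc2 : 0 ≤ (5 + 3 * K) / (2 * (1 - I.β) * I.α₂ * I.β) := by positivity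
  have hc1' : 5 / (2 * I.α₂ * I.β) ≤ rateConst I.α₁ I.α₂ I.β := by rw [hc]; linarith
  have hc2' : (5 + 3 * K) / (2 * (1 - I.β) * I.α₂ * I.β) ≤ rateConst I.α₁ I.α₂ I.β := by
    rw [hc]; linarith
  have hc0 : 0 ≤ rateConst I.α₁ I.α₂ I.β := hc1.trans hc1'
  rw [mul_min_of_nonneg _ _ (by positivity)]
  apply le_min
  · calc _ ≤ 5 * I.L₁ * M / (2 * I.α₂ * I.β * k) := hlin
      _ = 5 / (2 * I.α₂ * I.β) * 1 * I.L₁ * M * (1 / (k : ℝ)) := by field_simp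
      _ ≤ _ := by gcongr; exact le_add_of_nonneg_right hlam0
  · rcases Nat.eq_zero_or_pos d with hd | hd
    · -- in dimension zero all points coincide, so both sides vanish
      subst hd
      have hM0 : M = 0 := by
        rw [hMdef, maxDistSq]
        have : (fun z : Vec 0 => ‖I.z₀ - z‖ ^ 2) = fun _ => 0 := by
          funext z; rw [Subsingleton.elim I.z₀ z]; simp
        rw [this, hne.image_const, csSup_singleton]
      rw [hM0] at hlin ⊢
      simpa using hlin
    · have hw : 1 ≤ Real.sqrt d := Real.one_le_sqrt.mpr (by exact_mod_cast hd)
      have hq2 := Q₂_le h zs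
      rw [show d * L₂ * ‖I.z₀ - zs‖ / I.L₁ = d * lam by rw [hlam]; ring,
        Real.sqrt_mul (Nat.cast_nonneg d)] at hq2
      have hrate := rate_le hK.le hw hlam0 hk1 (Q₁_le h zs) hq2
      calc _ ≤ _ := r.gap_le_superlinear h hs P hD hne hk hzs
        _ ≤ I.L₁ * M / (2 * (1 - I.β) * I.α₂ * I.β) *
            ((5 + 3 * K) * (1 + lam) * (Real.sqrt d / (k : ℝ) ^ (1.25 : ℝ))) := by gcongr
        _ = (5 + 3 * K) / (2 * (1 - I.β) * I.α₂ * I.β) * (1 + lam) * I.L₁ * M *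
            (Real.sqrt d / (k : ℝ) ^ (1.25 : ℝ)) := by ring
        _ ≤ _ := by gcongr

/-! ### The probability of an oracle failure -/

theorem inv_mul_log_sq_le (n : ℕ) :
    1 / (((n : ℝ) + 3) * Real.log ((n : ℝ) + 3) ^ 2) ≤
      1 / Real.log ((n : ℝ) + 2) - 1 / Real.log ((n : ℝ) + 3) := by
  have hn : (0 : ℝ) ≤ n := Nat.cast_nonneg n
  have h1 : 0 < Real.log ((n : ℝ) + 2) := Real.log_pos (by linarith)
  have h2 : Real.log ((n : ℝ) + 2) ≤ Real.log ((n : ℝ) + 3) :=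
    Real.log_le_log (by linarith) (by linarith)
  have h3 : 0 < Real.log ((n : ℝ) + 3) := h1.trans_le h2
  have h4 : 1 / ((n : ℝ) + 3) ≤ Real.log ((n : ℝ) + 3) - Real.log ((n : ℝ) + 2) := by
    have h5 := Real.log_le_sub_one_of_pos (x := ((n : ℝ) + 2) / ((n : ℝ) + 3)) (by positivity)
    rw [Real.log_div (by linarith) (by linarith)] at h5
    have : ((n : ℝ) + 2) / ((n : ℝ) + 3) - 1 = -(1 / ((n : ℝ) + 3)) := by field_simp; ring
    linarith
  rw [div_sub_div _ _ h1.ne' h3.ne', one_mul, mul_one]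
  calc 1 / (((n : ℝ) + 3) * Real.log ((n : ℝ) + 3) ^ 2)
      = 1 / ((n : ℝ) + 3) / Real.log ((n : ℝ) + 3) ^ 2 := by rw [div_div]
    _ ≤ (Real.log ((n : ℝ) + 3) - Real.log ((n : ℝ) + 2)) / Real.log ((n : ℝ) + 3) ^ 2 := by gcongr
    _ ≤ _ := by
      apply div_le_div_of_nonneg_left (by linarith) (by positivity)
      nlinarith

theorem sum_inv_mul_log_sq_le (N : ℕ) :
    ∑ i ∈ Finset.range N, 1 / (((i : ℝ) + 2) * Real.log ((i : ℝ) + 2) ^ 2) ≤ 2.5 := by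
  have hl := Real.log_two_gt_d9
  have key : ∀ n : ℕ, ∑ i ∈ Finset.range (n + 1), 1 / (((i : ℝ) + 2) * Real.log ((i : ℝ) + 2) ^ 2)
      ≤ 1 / (2 * Real.log 2 ^ 2) + 1 / Real.log 2 - 1 / Real.log ((n : ℝ) + 2) := by
    intro n
    induction n with
    | zero => simp
    | succ n ih =>
      rw [Finset.sum_range_succ]
      have := inv_mul_log_sq_le n
      push_cast
      rw [show (n : ℝ) + 1 + 2 = n + 3 by ring]
      linarith
  have hconst : 1 / (2 * Real.log 2 ^ 2) + 1 / Real.log 2 ≤ 2.5 := by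
    have h0 : 0 < Real.log 2 := by linarith
    rw [div_add_div _ _ (by positivity) h0.ne', div_le_iff₀ (by positivity)]
    have h1 : 1 + 2 * Real.log 2 ≤ 5 * Real.log 2 ^ 2 := by nlinarith
    nlinarith
  rcases N with _ | n
  · norm_num
  · have h1 : 0 ≤ 1 / Real.log ((n : ℝ) + 2) :=
      (one_div_pos.mpr (Real.log_pos (by linarith [Nat.cast_nonneg (α := ℝ) n]))).le
    linarith [key n]

theorem sum_failProb_le {p : ℝ} (hp : 0 ≤ p) (N : ℕ) :
    ∑ i ∈ Finset.range N, failProb p (i + 1) ≤ p := by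
  have e : ∀ i : ℕ, failProb p (i + 1) =
      p / 2.5 * (1 / (((i : ℝ) + 2) * Real.log ((i : ℝ) + 2) ^ 2)) := by
    intro i
    unfold failProb
    push_cast
    rw [show (i : ℝ) + 1 + 1 = i + 2 by ring, div_mul_div_comm, mul_one, mul_assoc]
  simp only [e, ← Finset.mul_sum]
  calc _ ≤ p / 2.5 * 2.5 := by gcongr; exact sum_inv_mul_log_sq_le N
    _ = p := by field_simp

theorem failProb_nonneg {p : ℝ} (hp : 0 ≤ p) (t : ℕ) : 0 ≤ failProb p t := by
  unfold failProb; positivity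

open MeasureTheory in
/-- Outside a measurable event of probability at most `p`, all oracle calls succeed. The failure
events need not be measurable, so their union is enclosed in a measurable set. -/
theorem exists_measurable_successful {I : Input d} {p : ℝ} (hp : 0 ≤ p) {Ω : Type*}
    [MeasurableSpace Ω] (P : Measure Ω) [IsProbabilityMeasure P] (run : Ω → Run I)
    (hext : ∀ t, 1 ≤ t → P {ω | (run ω).Reaches t ∧
      ¬ ExtEvecSuccess ((run ω).W t) (I.δ t) ((run ω).ext t)} ≤
        ENNReal.ofReal (failProb p t / 2))
    (hsvd : ∀ t, 1 ≤ t → P {ω | (run ω).Reaches t ∧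
      ¬ MaxSvecSuccess ((run ω).W t) (I.δ t) ((run ω).svd t)} ≤
        ENNReal.ofReal (failProb p t / 2)) :
    ∃ A : Set Ω, MeasurableSet A ∧ ENNReal.ofReal (1 - p) ≤ P A ∧
      ∀ ω ∈ A, (run ω).Successful := by
  set bad : ℕ → Set Ω := fun t =>
    {ω | (run ω).Reaches t ∧ ¬ ExtEvecSuccess ((run ω).W t) (I.δ t) ((run ω).ext t)} ∪
    {ω | (run ω).Reaches t ∧ ¬ MaxSvecSuccess ((run ω).W t) (I.δ t) ((run ω).svd t)} with hbad
  have hq := failProb_nonneg hp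
  have h1 : ∀ i : ℕ, P (bad (i + 1)) ≤ ENNReal.ofReal (failProb p (i + 1)) := by
    intro i
    refine (measure_union_le _ _).trans
      ((add_le_add (hext _ (by omega)) (hsvd _ (by omega))).trans (le_of_eq ?_))
    rw [← ENNReal.ofReal_add (by linarith [hq (i + 1)]) (by linarith [hq (i + 1)]), add_halves]
  set U := ⋃ i : ℕ, bad (i + 1) with hU
  have h2 : P U ≤ ENNReal.ofReal p := by
    refine (measure_iUnion_le _).trans (ENNReal.tsum_le_of_sum_range_le fun n => ?_)
    calc _ ≤ ∑ i ∈ Finset.range n, ENNReal.ofReal (failProb p (i + 1)) :=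
          Finset.sum_le_sum fun i _ => h1 i
      _ = ENNReal.ofReal (∑ i ∈ Finset.range n, failProb p (i + 1)) :=
          (ENNReal.ofReal_sum_of_nonneg fun i _ => hq _).symm
      _ ≤ _ := ENNReal.ofReal_le_ofReal (sum_failProb_le hp n)
  refine ⟨(toMeasurable P U)ᶜ, (measurableSet_toMeasurable P U).compl, ?_, fun ω hω t ht hr => ?_⟩
  · rw [prob_compl_eq_one_sub (measurableSet_toMeasurable P U), measure_toMeasurable,
      ENNReal.ofReal_sub _ hp, ENNReal.ofReal_one]
    exact tsub_le_tsub_left h2 1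
  · have hω' : ω ∉ bad t := fun hmem => hω (subset_toMeasurable P U
      (Set.mem_iUnion.mpr ⟨t - 1, by rwa [Nat.sub_add_cancel ht]⟩))
    simp only [hbad, Set.mem_union, Set.mem_ofPred_eq, not_or, not_and, not_not] at hω'
    exact ⟨hω'.1 hr, hω'.2 hr⟩

end QNPE

theorem theorem6p13 (α₁ α₂ β : ℝ) (hα₁ : 0 < α₁ ∧ α₁ < 1 / 2) (hα₂ : 0 < α₂ ∧ α₂ < 1 / 2)
    (hβ : 0 < β ∧ β < 1) :
    ∃ c : ℝ, 0 < c ∧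
    ∀ (d : ℕ) (I : QNPE.Input d) (L₂ p : ℝ),
    -- `F` is monotone and `L₁`-Lipschitz, with `L₂`-Lipschitz Jacobian
    (∀ z z', 0 ≤ inner ℝ (I.F z - I.F z') (z - z')) →
    0 < I.L₁ → (∀ z z', ‖I.F z - I.F z'‖ ≤ I.L₁ * ‖z - z'‖) →
    Differentiable ℝ I.F →
    0 ≤ L₂ → (∀ z z', ‖fderiv ℝ I.F z - fderiv ℝ I.F z'‖ ≤ L₂ * ‖z - z'‖) →
    -- the subspace contains the identity and the Jacobians
    (1 : QNPE.Mat d) ∈ I.𝓛 → (∀ z, QNPE.jac I.F z ∈ I.𝓛) →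
    -- parameters of the algorithm
    I.α₁ = α₁ → I.α₂ = α₂ → I.β = β → α₂ * β / (5 * I.L₁) ≤ I.σ₀ →
    I.B₀ ∈ QNPE.setZ I.L₁ I.𝓛 →
    I.ρ = 1 / 121 → I.δ = QNPE.delta →
    (∀ A ∈ QNPE.setC I.𝓛, QNPE.frobNorm A ≤ I.R) → I.R ≤ 3 * Real.sqrt d →
    0 < p → p < 1 →
    -- `Q₁ = O(√d)` and `Q₂ = O(√(d L₂ ‖z₀ - z*‖ / L₁))`
    (∀ zs, I.F zs = 0 →
      QNPE.Q₁ I L₂ zs ≤ c * (Real.sqrt d + L₂ * ‖I.z₀ - zs‖ / I.L₁) ∧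
      QNPE.Q₂ I L₂ zs ≤ c * (Real.sqrt (d * L₂ * ‖I.z₀ - zs‖ / I.L₁) + 1)) ∧
    -- the random executions; each oracle call in round `t` fails with probability at most `q_t / 2`
    ∀ (Ω : Type*) (_ : MeasurableSpace Ω) (P : MeasureTheory.Measure Ω)
      (_ : MeasureTheory.IsProbabilityMeasure P) (run : Ω → QNPE.Run I),
    (∀ t, 1 ≤ t → P {ω | (run ω).Reaches t ∧
      ¬ QNPE.ExtEvecSuccess ((run ω).W t) (I.δ t) ((run ω).ext t)} ≤
        ENNReal.ofReal (QNPE.failProb p t / 2)) →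
    (∀ t, 1 ≤ t → P {ω | (run ω).Reaches t ∧
      ¬ QNPE.MaxSvecSuccess ((run ω).W t) (I.δ t) ((run ω).svd t)} ≤
        ENNReal.ofReal (QNPE.failProb p t / 2)) →
    -- with probability at least `1 - p`
    ∃ A : Set Ω, MeasurableSet A ∧ ENNReal.ofReal (1 - p) ≤ P A ∧ ∀ ω ∈ A,
      (∀ zs, I.F zs = 0 → ∀ k, ‖(run ω).z (k + 1) - zs‖ ≤ ‖(run ω).z k - zs‖) ∧
      ∀ (prob : QNPE.Problem I.F) (D : Set (QNPE.Vec d)), IsCompact D → D.Nonempty →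
      ∀ k : ℕ, 1 ≤ k →
        prob.gap D ((run ω).avg k) ≤
          5 * I.L₁ * QNPE.maxDistSq I.z₀ D / (2 * α₂ * β * k) ∧
        ∀ zs, I.F zs = 0 →
          prob.gap D ((run ω).avg k) ≤
            I.L₁ * QNPE.maxDistSq I.z₀ D / (2 * (1 - β) * α₂ * β) *
              (5 / (k : ℝ) ^ 2 + QNPE.Q₁ I L₂ zs / (k : ℝ) ^ (1.5 : ℝ) +
                QNPE.Q₂ I L₂ zs / (k : ℝ) ^ (1.25 : ℝ)) ∧
          prob.gap D ((run ω).avg k) ≤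
            c * (1 + L₂ * ‖I.z₀ - zs‖ / I.L₁) * I.L₁ * QNPE.maxDistSq I.z₀ D *
              min (1 / (k : ℝ)) (Real.sqrt d / (k : ℝ) ^ (1.25 : ℝ)) := by
  refine ⟨QNPE.rateConst α₁ α₂ β, (QNPE.coeffConst_pos α₁ α₂ β).trans_le
    (QNPE.coeffConst_le_rateConst hα₂.1 hβ.1 hβ.2), ?_⟩
  intro d I L₂ p hmono hL₁ hlip hdiff hL₂ hlip' hone hjac e₁ e₂ e₃ hσ hB hρ hδ hR hR' hp _
  subst e₁ e₂ e₃
  have h : QNPE.Admissible I L₂ :=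
    ⟨hmono, hL₁, hlip, hdiff, hL₂, hlip', hone, hjac, hα₁.1, hα₁.2, hα₂.1, hα₂.2, hβ.1, hβ.2, hσ,
      hB, hρ, hδ, hR, hR'⟩
  have hK := QNPE.coeffConst_le_rateConst (α₁ := I.α₁) hα₂.1 hβ.1 hβ.2
  refine ⟨fun zs _ => ⟨?_, ?_⟩, ?_⟩
  · exact (QNPE.Q₁_le h zs).trans (mul_le_mul_of_nonneg_right hK (by positivity))
  · exact (QNPE.Q₂_le h zs).trans (mul_le_mul_of_nonneg_right hK (by positivity))
  · intro Ω _ P _ run hext hsvd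
    obtain ⟨A, hA, hPA, hsucc⟩ := QNPE.exists_measurable_successful hp.le P run hext hsvd
    refine ⟨A, hA, hPA, fun ω hω => ⟨fun zs hzs k => ?_, fun prob D hD hne k hk => ?_⟩⟩
    · exact (run ω).norm_z_succ_sub_zero_le h hzs k
    · exact ⟨(run ω).gap_le_linear h (hsucc ω hω) prob hD hne hk, fun zs hzs =>
        ⟨(run ω).gap_le_superlinear h (hsucc ω hω) prob hD hne hk hzs,
          (run ω).gap_le_rate h (hsucc ω hω) prob hD hne hk hzs⟩⟩
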